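/- Let $G=(V,E)$ be a finite undirected graph with $n=|V|$ vertices, which is fixed and public. The private input is a vector of nonnegative edge weights $w\in\mathbb{R}_{\ge 0}^E$; two inputs $w,w'$ are neighbors if $\|w-w'\|_1\le 1$. Write $\mathrm{dist}_w(u,v)$ for the smallest weight of a path from $u$ to $v$ ($+\infty$ if there is none). A randomized algorithm $M$ for all-pairs shortest path distances outputs an estimate $\tilde d(u,v)$ for all $u,v\in V$. It is $\varepsilon$-DP if $\Pr[M(w)\in S]\le e^{\varepsilon}\Pr[M(w')\in S]$ for all neighbors $w,w'$ and all measurable sets $S$ of outputs. The output is $(\gamma,\alpha)$-accurate on $w$ if $$\mathrm{dist}_w(u,v)-\alpha\le\tilde d(u,v)\le\gamma\cdot\mathrm{dist}_w(u,v)+\alpha\qquad\text{for all }u,v\in V.$$ **Theorem.** There is an absolute constant $C>0$ such that for every integer $k\ge 1$, every $\varepsilon>0$ and every finite graph $G$ on $n$ vertices there is an $\varepsilon$-DP algorithm for all-pairs shortest path distances on $G$ whose output, on every input $w$, is $$\left(2k-1,\ C\cdot\frac{k\cdot n^{(k+1)/(2k+1)}\log^2 n}{\varepsilon}\right)\text{-accurate}$$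 with probability at least $1-C/n$. -/

import Mathlib

open MeasureTheory ProbabilityTheory
open scoped NNReal

universe u

namespace PrivateAPSD

/-- Nonnegative edge weights on the fixed (public) graph `G`. These are the private inputs. -/
abbrev Weights {V : Type u} (G : SimpleGraph V) : Type u := G.edgeSet → ℝ≥0

/-- Two weight vectors are neighbors when their `ℓ₁`-distance is at most `1`. -/
def Neighbors {V : Type u} {G : SimpleGraph V} [Fintype G.edgeSet] (w w' : Weights G) : Prop :=
  ∑ e, |(w e : ℝ) - (w' e : ℝ)| ≤ 1

/-- The weight of a walk: the sum of the weights of its edges. -/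
def walkWeight {V : Type u} {G : SimpleGraph V} (w : Weights G) :
    {a b : V} → G.Walk a b → ℝ≥0
  | _, _, .nil => 0
  | _, _, .cons h p => w ⟨_, G.mem_edgeSet.mpr h⟩ + walkWeight w p

/-- Shortest path distance: the smallest weight of a path from `a` to `b`
(it is `⊤` when there is no such path). -/
noncomputable def wdist {V : Type u} {G : SimpleGraph V} (w : Weights G) (a b : V) : EReal :=
  ⨅ p : G.Path a b, ((walkWeight w (p : G.Walk a b) : ℝ) : EReal)

/-- A table of estimated distances, one for each pair of vertices. -/
abbrev Estimates (V : Type u) : Type u := V → V → EReal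

/-- `(γ, α)`-accuracy of a table of estimates: multiplicative error `γ`, additive error `α`. -/
def IsAccurate {V : Type u} {G : SimpleGraph V} (w : Weights G) (γ α : ℝ)
    (d : Estimates V) : Prop :=
  ∀ a b : V, wdist w a b - (α : EReal) ≤ d a b ∧ d a b ≤ (γ : EReal) * wdist w a b + (α : EReal)

/-- A randomized algorithm for all-pairs shortest path distances on the graph `G`, seen through
the law of its output on each input, is `(ε, δ)`-differentially private. -/
def IsDP {V : Type u} {G : SimpleGraph V} [Fintype G.edgeSet]
    (M : Kernel (Weights G) (Estimates V)) (ε δ : ℝ) : Prop :=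
  ∀ w w' : Weights G, Neighbors w w' → ∀ S : Set (Estimates V), MeasurableSet S →
    M w S ≤ ENNReal.ofReal (Real.exp ε) * M w' S + ENNReal.ofReal δ

end PrivateAPSD

/-! Fix a length `L` and a number `m` with `m * L` about `n log n`. Some set `S` of `m` vertices
meets the first `L` vertices of one chosen shortest path for every pair whose chosen path is long
(`exists_hittingSet`, `exists_prefix`). So a shortest path from `a` to `b` may be replaced by at
most `L` edges at either end and a jump between two points of `S`. A greedy spanner of the distance
metric on `S` has high girth, hence by the Moore bound about `m ^ (1 + 1 / k)` edges
(`HighGirth.card_edgeFinset_le`), and it replaces each jump by at most `2k - 1` shortcuts no longer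
than the jump. Thus for every `w` some list of `p` shortcuts has stretch `2k - 1` with no additive
error (`exists_score_eq_zero`).

That list depends on the private weights, so it is selected by the exponential mechanism. The score
is the excess over stretch `2k - 1`; its sensitivity is `4k` and there are at most `n ^ (2p)` lists,
so the excess is `O(k p log n / ε)`. Laplace noise of scale `O(1 / ε)` on the edge weights and `O(p
/ ε)` on the shortcut lengths makes the rest public: each estimate is the cheapest noisy route with
at most `2L` edges and fewer than `2k` shortcuts. The noise of a route is `O((L + k p) log n / ε)`.
Taking `m` about `n ^ (k / (2k + 1))` makes both `p` and `L / log n` of order `n ^ ((k + 1) / (2k +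
1))`. -/

namespace PrivateAPSD

open SimpleGraph

/-! ### Greedy hitting sets -/

section HittingSet

open Classical in
/-- A family of large sets has a small hitting set. -/
theorem exists_hittingSet {V : Type*} [Fintype V] {ι : Type*} (L m : ℕ) (I : Finset ι)
    (P : ι → Finset V) (hP : ∀ i ∈ I, L ≤ (P i).card)
    (h : (I.card : ℝ) * Real.exp (-((m : ℝ) * L / Fintype.card V)) < 1) :
    ∃ S : Finset V, S.card ≤ m ∧ ∀ i ∈ I, ∃ x ∈ S, x ∈ P i := by
  induction m generalizing I with
  | zero =>
    have : I.card = 0 := by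
      have : (I.card : ℝ) < 1 := by simpa using h
      exact Nat.lt_one_iff.mp (by exact_mod_cast this)
    exact ⟨∅, by simp, by simp [Finset.card_eq_zero.mp this]⟩
  | succ m ih =>
    rcases I.eq_empty_or_nonempty with rfl | ⟨i₀, hi₀⟩
    · exact ⟨∅, by simp, by simp⟩
    rcases Nat.eq_zero_or_pos (Fintype.card V) with h0 | hV
    · have : (1 : ℝ) ≤ I.card := by exact_mod_cast Finset.card_pos.mpr ⟨i₀, hi₀⟩
      simp only [h0, Nat.cast_zero, div_zero, neg_zero, Real.exp_zero, mul_one] at h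
      linarith
    have hn : (0 : ℝ) < Fintype.card V := by exact_mod_cast hV
    -- By averaging, some vertex lies in at least a fraction `L / n` of the sets. Choosing it leaves
    -- at most a fraction `1 - L / n ≤ exp (-L / n)`, which pays for one step of the induction.
    obtain ⟨v, hv⟩ : ∃ v : V, I.card * L ≤
        Fintype.card V * (I.filter (fun i => v ∈ P i)).card := by
      by_contra! hcon
      have h1 : ∑ v : V, (I.filter (fun i => v ∈ P i)).card = ∑ i ∈ I, (P i).card := by
        simp_rw [Finset.card_filter]
        rw [Finset.sum_comm]
        refine Finset.sum_congr rfl fun i _ => ?_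
        simp
      have h2 : I.card * L ≤ ∑ i ∈ I, (P i).card := by
        simpa using Finset.card_nsmul_le_sum I (fun i => (P i).card) L hP
      have h3 : ∑ v : V, Fintype.card V * (I.filter (fun i => v ∈ P i)).card
          < ∑ _v : V, I.card * L :=
        Finset.sum_lt_sum_of_nonempty (Finset.card_pos.mp (by simpa using hV))
          fun v _ => hcon v
      rw [← Finset.mul_sum, h1] at h3
      simp only [Finset.sum_const, Finset.card_univ, smul_eq_mul] at h3
      exact absurd (Nat.mul_le_mul_left (Fintype.card V) h2) (not_le.mpr h3)
    obtain ⟨S, hS, hit⟩ := ih (I.filter (fun i => v ∉ P i))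
      (fun i hi => hP i (Finset.mem_filter.mp hi).1) (by
        refine lt_of_le_of_lt ?_ h
        have hsplit := Finset.card_filter_add_card_filter_not (s := I) (fun i => v ∈ P i)
        have hs : ((I.filter (fun i => v ∈ P i)).card : ℝ)
            + (I.filter (fun i => v ∉ P i)).card = I.card := by exact_mod_cast hsplit
        have hv' : (I.card : ℝ) * L ≤
          Fintype.card V * (I.filter (fun i => v ∈ P i)).card := by exact_mod_cast hv
        have h4 : ((I.filter (fun i => v ∉ P i)).card : ℝ)
            ≤ I.card * Real.exp (-((L : ℝ) / Fintype.card V)) := by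
          have h5 : (I.card : ℝ) * (L / Fintype.card V)
              ≤ (I.filter (fun i => v ∈ P i)).card := by
            rw [← mul_div_assoc, div_le_iff₀ hn]
            linarith
          have h6 := Real.add_one_le_exp (-((L : ℝ) / Fintype.card V))
          have h7 : (I.card : ℝ) * (-((L : ℝ) / Fintype.card V) + 1)
              ≤ I.card * Real.exp (-((L : ℝ) / Fintype.card V)) :=
            mul_le_mul_of_nonneg_left h6 (Nat.cast_nonneg _)
          linarith
        refine (mul_le_mul_of_nonneg_right h4 (Real.exp_nonneg _)).trans (le_of_eq ?_)
        rw [mul_assoc, ← Real.exp_add]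
        congr 2
        push_cast
        ring)
    refine ⟨insert v S, (Finset.card_insert_le _ _).trans (by omega), fun i hi => ?_⟩
    by_cases hvi : v ∈ P i
    · exact ⟨v, by simp, hvi⟩
    · obtain ⟨x, hx, hxi⟩ := hit i (by simp [hi, hvi])
      exact ⟨x, by simp [hx], hxi⟩

end HittingSet

/-! ### Graphs of high girth: greedy spanners and the Moore bound -/

section HighGirth

variable {V : Type*}

/-- No edge of `H` lies on a cycle with at most `g` edges. -/
def HighGirth (H : SimpleGraph V) (g : ℕ) : Prop :=
  ∀ ⦃a b : V⦄ (p : H.Walk a b), H.Adj a b → p.length < g → s(a, b) ∈ p.edges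

theorem HighGirth.mono {H K : SimpleGraph V} {g : ℕ} (hK : HighGirth K g) (h : H ≤ K) :
    HighGirth H g := by
  intro a b p hab hp
  have := hK (p.mapLe h) (h hab) (by simpa using hp)
  simpa using this

theorem exists_split_of_mem_edges {H : SimpleGraph V} {c d : V} (p : H.Walk c d) {e : Sym2 V}
    (he : e ∈ p.edges) (hp : p.edges.Nodup) :
    ∃ (a b : V) (p₁ : H.Walk c a) (p₂ : H.Walk b d), e = s(a, b) ∧ e ∉ p₁.edges ∧
      e ∉ p₂.edges ∧ (∀ f ∈ p₁.edges, f ∈ p.edges) ∧ (∀ f ∈ p₂.edges, f ∈ p.edges) ∧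
      p₁.length + p₂.length + 1 = p.length := by
  induction p with
  | nil => simp at he
  | @cons u v w huv q ih =>
    rw [Walk.edges_cons, List.nodup_cons] at hp
    by_cases heq : e = s(u, v)
    · exact ⟨u, v, .nil, q, heq, by simp, heq ▸ hp.1, by simp,
        fun f hf => by simp [hf], by simp⟩
    · rw [Walk.edges_cons, List.mem_cons] at he
      obtain ⟨a, b, p₁, p₂, h1, h2, h3, h4, h5, h6⟩ := ih (he.resolve_left heq) hp.2
      refine ⟨a, b, .cons huv p₁, p₂, h1, by simp [heq, h2], h3, ?_, ?_, ?_⟩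
      · intro f hf
        rw [Walk.edges_cons, List.mem_cons] at hf ⊢
        exact hf.imp id (h4 f)
      · intro f hf
        rw [Walk.edges_cons, List.mem_cons]
        exact Or.inr (h5 f hf)
      · simp only [Walk.length_cons]; omega

/-- Joining two vertices without short connection keeps the girth high. -/
theorem HighGirth.sup_edge {H : SimpleGraph V} {g : ℕ} (hH : HighGirth H g) {a b : V}
    (hab : ∀ p : H.Walk a b, g ≤ p.length) : HighGirth (H ⊔ edge a b) g := by
  classical
  have hmem : ∀ f ∈ (H ⊔ edge a b).edgeSet, f ≠ s(a, b) → f ∈ H.edgeSet := by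
    intro f
    induction f with | _ x y =>
    intro hf hne
    simp only [mem_edgeSet, sup_adj, edge_adj] at hf ⊢
    rcases hf with hf | ⟨⟨rfl, rfl⟩ | ⟨rfl, rfl⟩, -⟩
    · exact hf
    · exact absurd rfl hne
    · exact absurd Sym2.eq_swap hne
  have key : ∀ (x y : V), s(a, b) = s(x, y) → ∀ p : H.Walk x y, g ≤ p.length := by
    intro x y hxy p
    rcases Sym2.eq_iff.mp hxy with ⟨rfl, rfl⟩ | ⟨rfl, rfl⟩
    · exact hab p
    · simpa using hab p.reverse
  intro c d p hcd hp
  by_contra hnot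
  set q := p.bypass with hq
  have hqp : q.IsPath := p.bypass_isPath
  have hqlen : q.length < g := (p.length_bypass_le_length).trans_lt hp
  have hqnot : s(c, d) ∉ q.edges := fun h => hnot (p.edges_bypass_subset_edges h)
  -- If `q` uses the new edge, then `s(c, d)` is an old edge, and deleting the new edge from the
  -- cycle formed by `q` and `s(c, d)` leaves an old walk between `a` and `b` with `q.length < g`
  -- edges. Otherwise `q` lies in `H` and contradicts `hab` or `hH`.
  by_cases hcase : s(a, b) ∈ q.edges
  · have hcdH : H.Adj c d := by
      refine hmem s(c, d) hcd fun h => hqnot (h ▸ hcase)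
    obtain ⟨x, y, p₁, p₂, h1, h2, h3, -, -, h6⟩ :=
      exists_split_of_mem_edges q hcase hqp.isTrail.edges_nodup
    let r₁ := p₁.transfer H fun f hf =>
      hmem f (p₁.edges_subset_edgeSet hf) (fun h => h2 (h ▸ hf))
    let r₂ := p₂.transfer H fun f hf =>
      hmem f (p₂.edges_subset_edgeSet hf) (fun h => h3 (h ▸ hf))
    have := key x y h1 ((r₁.reverse.append (.cons hcdH .nil)).append r₂.reverse)
    simp [r₁, r₂] at this
    omega
  · let r := q.transfer H fun f hf =>
      hmem f (q.edges_subset_edgeSet hf) (fun h => hcase (h ▸ hf))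
    have hr : r.length = q.length := by simp [r]
    by_cases heq : s(a, b) = s(c, d)
    · have := key c d heq r
      omega
    · have := hH r (hmem s(c, d) hcd (Ne.symm heq)) (by omega)
      exact hqnot (by simpa [r] using this)

open Classical in
/-- The greedy spanner, with bottleneck stretch. -/
theorem exists_greedy_spanner (wt : Sym2 V → ℝ) (g : ℕ) (hg : 2 ≤ g) (T : Finset (Sym2 V)) :
    ∃ H : SimpleGraph V, H.edgeSet ⊆ T ∧ HighGirth H g ∧
      ∀ x y, x ≠ y → s(x, y) ∈ T →
        ∃ p : H.Walk x y, p.length < g ∧ ∀ e ∈ p.edges, wt e ≤ wt s(x, y) := by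
  -- Pairs arrive in order of increasing weight, so any connection already present when `e` arrives
  -- uses only edges of weight at most `wt e`.
  induction T using Finset.induction_on_max_value wt with
  | empty => exact ⟨⊥, by simp, fun a b p h => by simp at h, by simp⟩
  | insert e T he hmax ih =>
    obtain ⟨H, hT, hH, hsp⟩ := ih
    induction e with | _ a b =>
    by_cases hab : a = b
    · refine ⟨H, hT.trans (by simp), hH, fun x y hxy hmem => hsp x y hxy ?_⟩
      refine (Finset.mem_insert.mp hmem).resolve_left fun h => hxy ?_
      subst hab
      rcases Sym2.eq_iff.mp h with ⟨rfl, rfl⟩ | ⟨rfl, rfl⟩ <;> rfl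
    by_cases hw : ∃ p : H.Walk a b, p.length < g
    · obtain ⟨p, hp⟩ := hw
      have hpe : ∀ e ∈ p.edges, wt e ≤ wt s(a, b) := fun e h =>
        hmax e (hT (p.edges_subset_edgeSet h))
      refine ⟨H, hT.trans (by simp), hH, fun x y hxy hmem => ?_⟩
      rcases Finset.mem_insert.mp hmem with h | h
      · rw [h]
        rcases Sym2.eq_iff.mp h with ⟨rfl, rfl⟩ | ⟨rfl, rfl⟩
        · exact ⟨p, hp, hpe⟩
        · exact ⟨p.reverse, by simpa using hp, by simpa using hpe⟩
      · exact hsp x y hxy h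
    · push Not at hw
      have hadj : (H ⊔ edge a b).Adj a b := by simp [edge_adj, hab]
      refine ⟨H ⊔ edge a b, ?_, hH.sup_edge hw, fun x y hxy hmem => ?_⟩
      · intro f
        induction f with | _ x y =>
        simp only [mem_edgeSet, sup_adj, edge_adj]
        rintro (h | ⟨⟨rfl, rfl⟩ | ⟨rfl, rfl⟩, -⟩)
        · exact Finset.mem_coe.mpr (Finset.mem_insert_of_mem (hT h))
        · simp
        · simp [Sym2.eq_swap]
      rcases Finset.mem_insert.mp hmem with h | h
      · rw [h]
        rcases Sym2.eq_iff.mp h with ⟨rfl, rfl⟩ | ⟨rfl, rfl⟩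
        · exact ⟨.cons hadj .nil, by simp; omega, by simp⟩
        · exact ⟨.cons hadj.symm .nil, by simp; omega, by simp [Sym2.eq_swap]⟩
      · obtain ⟨p, hp, hpe⟩ := hsp x y hxy h
        exact ⟨p.mapLe le_sup_left, by simpa using hp, by simpa using hpe⟩

/-- Shortest walks from `v` to two different neighbors of `x` would close up through `x` to a cycle
that is too short. They avoid `x` themselves, since a walk through `x` that ends elsewhere is longer
than `K.dist v x`. -/
theorem HighGirth.eq_of_adj {K : SimpleGraph V} {g : ℕ} (hK : HighGirth K g) {v x y₁ y₂ : V}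
    (h₁ : K.Adj y₁ x) (h₂ : K.Adj y₂ x) (hr : K.Reachable v x)
    (hd₁ : K.dist v y₁ ≤ K.dist v x) (hd₂ : K.dist v y₂ ≤ K.dist v x)
    (hg : K.dist v y₁ + K.dist v y₂ + 1 < g) : y₁ = y₂ := by
  classical
  by_contra hne
  obtain ⟨p₁, hp₁⟩ := (hr.trans h₁.symm.reachable).exists_walk_length_eq_dist
  obtain ⟨p₂, hp₂⟩ := (hr.trans h₂.symm.reachable).exists_walk_length_eq_dist
  have aux : ∀ {y : V} (p : K.Walk v y), K.Adj y x → p.length ≤ K.dist v x →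
      x ∉ p.support := by
    intro y p hy hp hx
    have h1 := p.length_takeUntil_lt_length hx hy.ne'
    have h2 := dist_le (p.takeUntil x hx)
    omega
  have := hK (p₁.reverse.append (p₂.concat h₂)) h₁ (by simp; omega)
  simp only [Walk.edges_append, Walk.edges_reverse, Walk.edges_concat, List.mem_append,
    List.mem_reverse, List.concat_eq_append, List.mem_singleton] at this
  rcases this with h | h | h
  · exact aux p₁ h₁ (by omega) (p₁.snd_mem_support_of_mem_edges h)
  · exact aux p₂ h₂ (by omega) (p₂.snd_mem_support_of_mem_edges h)
  · rcases Sym2.eq_iff.mp h with ⟨h, -⟩ | ⟨h, -⟩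
    · exact hne h
    · exact h₁.ne h

open Classical in
/-- Moore bound: balls in a graph of high girth and large minimum degree are large. -/
theorem HighGirth.pow_le_card [Fintype V] {K : SimpleGraph V} {k D : ℕ}
    (hK : HighGirth K (2 * k)) (v : V)
    (hdeg : ∀ x, K.Reachable v x → D + 1 ≤ K.degree x) : D ^ k ≤ Fintype.card V := by
  let S : ℕ → Finset V := fun i => Finset.univ.filter fun x => K.Reachable v x ∧ K.dist v x = i
  have hS : ∀ i ≤ k, D ^ i ≤ (S i).card := by
    intro i
    induction i with
    | zero =>
      intro _
      rw [pow_zero]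
      exact Finset.card_pos.mpr ⟨v, by simp [S]⟩
    | succ i ih =>
      intro hi
      -- Double counting between consecutive spheres: a vertex has at most one neighbor that is not
      -- in the next sphere, hence at least `D` in it, and a vertex of the next sphere has at most
      -- one neighbor in the previous one.
      have h := Finset.card_mul_le_card_mul (s := S i) (t := S (i + 1)) (m := D) (n := 1) K.Adj
        (by
          intro x hx
          obtain ⟨hr, hd⟩ : K.Reachable v x ∧ K.dist v x = i := by simpa [S] using hx
          have hle : ∀ y, K.Adj x y → K.dist v y ≤ i + 1 := by
            intro y hy
            obtain ⟨p, hp⟩ := hr.exists_walk_length_eq_dist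
            have := dist_le (p.concat hy)
            simp at this
            omega
          have hsplit := Finset.card_filter_add_card_filter_not (s := K.neighborFinset x)
            (fun y => K.dist v y = i + 1)
          rw [card_neighborFinset_eq_degree] at hsplit
          have h1 : ((K.neighborFinset x).filter (fun y => ¬ K.dist v y = i + 1)).card ≤ 1 := by
            rw [Finset.card_le_one]
            intro y₁ hy₁ y₂ hy₂
            simp only [Finset.mem_filter, mem_neighborFinset] at hy₁ hy₂
            have := hle y₁ hy₁.1
            have := hle y₂ hy₂.1
            exact hK.eq_of_adj hy₁.1.symm hy₂.1.symm hr (by omega) (by omega) (by omega)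
          have h2 : ((K.neighborFinset x).filter (fun y => K.dist v y = i + 1)).card
              ≤ ((S (i + 1)).bipartiteAbove K.Adj x).card := by
            refine Finset.card_le_card fun y hy => ?_
            simp only [Finset.mem_filter, mem_neighborFinset] at hy
            simp only [Finset.mem_bipartiteAbove, S, Finset.mem_filter, Finset.mem_univ, true_and]
            exact ⟨⟨hr.trans hy.1.reachable, hy.2⟩, hy.1⟩
          have := hdeg x hr
          omega)
        (by
          intro y hy
          obtain ⟨hr, hd⟩ : K.Reachable v y ∧ K.dist v y = i + 1 := by simpa [S] using hy
          rw [Finset.card_le_one]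
          intro x₁ hx₁ x₂ hx₂
          simp only [Finset.mem_bipartiteBelow, S, Finset.mem_filter, Finset.mem_univ,
            true_and] at hx₁ hx₂
          exact hK.eq_of_adj hx₁.2 hx₂.2 hr (by omega) (by omega) (by omega))
      calc D ^ (i + 1) = D ^ i * D := pow_succ _ _
        _ ≤ (S i).card * D := Nat.mul_le_mul_right _ (ih (by omega))
        _ ≤ (S (i + 1)).card := by simpa using h
  exact (hS k le_rfl).trans (Finset.card_le_univ _)

-- Vertices of degree at most `D` are deleted one by one, each costing at most `D` edges and at
-- least one vertex of the support. If edges remained with no such vertex left, all degrees in a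
-- component would exceed `D`, against the Moore bound.
open Classical in
theorem HighGirth.card_edgeFinset_le [Fintype V] {K : SimpleGraph V} {k D : ℕ}
    (hK : HighGirth K (2 * k)) (hD : Fintype.card V < D ^ k) :
    K.edgeFinset.card ≤ D * K.support.ncard := by
  induction hN : K.edgeFinset.card using Nat.strong_induction_on generalizing K with
  | _ N ih =>
    by_cases hN0 : N = 0
    · simp [hN0]
    by_cases hlow : ∃ x ∈ K.support, K.degree x ≤ D
    · obtain ⟨x, hx, hxD⟩ := hlow
      have hpos : 0 < K.degree x := by
        rw [degree_pos_iff_exists_adj]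
        exact hx
      have hcard : (K.deleteIncidenceSet x).edgeFinset.card = K.edgeFinset.card - K.degree x := by
        convert K.card_edgeFinset_deleteIncidenceSet x
      have hle : K.degree x ≤ K.edgeFinset.card := K.degree_le_card_edgeFinset x
      have h1 := ih (K.edgeFinset.card - K.degree x) (by omega)
        (hK.mono (K.deleteIncidenceSet_le x)) (by convert hcard)
      have h2 : (K.deleteIncidenceSet x).support.ncard + 1 ≤ K.support.ncard := by
        have hsub := K.support_deleteIncidenceSet_subset x
        exact Set.ncard_lt_ncard ⟨fun y hy => (hsub hy).1, fun h => (hsub (h hx)).2 rfl⟩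
      have h3 := Nat.mul_le_mul_left D h2
      rw [mul_add] at h3
      omega
    · push Not at hlow
      exfalso
      obtain ⟨e, he⟩ : K.edgeFinset.Nonempty := Finset.card_pos.mp (by omega)
      induction e with | _ v w =>
      rw [mem_edgeFinset, mem_edgeSet] at he
      refine absurd (hK.pow_le_card (D := D) v fun x hx => hlow x ?_) (not_le.mpr hD)
      by_cases hvx : v = x
      · exact hvx ▸ ⟨w, he⟩
      · obtain ⟨p⟩ := hx.symm
        cases p with
        | nil => exact absurd rfl hvx
        | cons h _ => exact ⟨_, h⟩

end HighGirth

/-! ### Connection by a set of edges -/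

section Joins

variable {V : Type*}

/-- The edges in `T` connect `a` to `b`. -/
def Joins (T : Set (Sym2 V)) (a b : V) : Prop := (fromEdgeSet T).Reachable a b

theorem Joins.refl (T : Set (Sym2 V)) (a : V) : Joins T a a := Reachable.refl a

theorem Joins.symm {T : Set (Sym2 V)} {a b : V} (h : Joins T a b) : Joins T b a :=
  Reachable.symm h

theorem Joins.trans {T : Set (Sym2 V)} {a b c : V} (h : Joins T a b) (h' : Joins T b c) :
    Joins T a c := Reachable.trans h h'

theorem Joins.mono {T T' : Set (Sym2 V)} {a b : V} (h : Joins T a b) (hT : T ⊆ T') :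
    Joins T' a b := Reachable.mono (fromEdgeSet_mono hT) h

theorem Joins.of_mem {T : Set (Sym2 V)} {a b : V} (h : s(a, b) ∈ T) : Joins T a b := by
  by_cases hab : a = b
  · exact hab ▸ Joins.refl T a
  · exact Adj.reachable ((fromEdgeSet_adj T).mpr ⟨h, hab⟩)

theorem Joins.of_walk {H : SimpleGraph V} {T : Set (Sym2 V)} {a b : V} (p : H.Walk a b)
    (hp : ∀ e ∈ p.edges, e ∈ T) : Joins T a b := by
  induction p with
  | nil => exact Joins.refl T _
  | cons h q ih =>
    simp only [Walk.edges_cons, List.mem_cons, forall_eq_or_imp] at hp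
    exact (Joins.of_mem hp.1).trans (ih hp.2)

theorem Joins.bind {T T' : Set (Sym2 V)} {a b : V} (h : Joins T a b)
    (hT : ∀ x y, s(x, y) ∈ T → Joins T' x y) : Joins T' a b := by
  obtain ⟨p⟩ := h
  induction p with
  | nil => exact Joins.refl T' _
  | cons h q ih => exact (hT _ _ ((fromEdgeSet_adj T).mp h).1).trans ih

end Joins

/-! ### Shortest path distances as minima over connecting edge sets -/

section Distance

variable {V : Type u} {G : SimpleGraph V}

/-- The set of pairs underlying a finite set of edges of `G`. -/
def pairs (F : Finset G.edgeSet) : Set (Sym2 V) := (↑) '' (F : Set G.edgeSet)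

theorem mem_pairs {F : Finset G.edgeSet} {e : Sym2 V} :
    e ∈ pairs F ↔ ∃ h : e ∈ G.edgeSet, ⟨e, h⟩ ∈ F := by
  simp [pairs]

theorem pairs_mono {F F' : Finset G.edgeSet} (h : F ⊆ F') : pairs F ⊆ pairs F' :=
  Set.image_mono (by exact_mod_cast h)

theorem Joins.reachable {F : Finset G.edgeSet} {a b : V} (h : Joins (pairs F) a b) :
    G.Reachable a b := by
  refine Reachable.mono (fun x y hxy => ?_) h
  obtain ⟨h', -⟩ := mem_pairs.mp ((fromEdgeSet_adj _).mp hxy).1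
  exact h'

/-- The weight of a set of edges. -/
def edgeWeight (w : Weights G) (F : Finset G.edgeSet) : ℝ := ∑ e ∈ F, (w e : ℝ)

theorem edgeWeight_nonneg (w : Weights G) (F : Finset G.edgeSet) : 0 ≤ edgeWeight w F :=
  Finset.sum_nonneg fun e _ => (w e).coe_nonneg

theorem edgeWeight_mono (w : Weights G) {F F' : Finset G.edgeSet} (h : F ⊆ F') :
    edgeWeight w F ≤ edgeWeight w F' :=
  Finset.sum_le_sum_of_subset_of_nonneg h fun e _ _ => (w e).coe_nonneg

theorem edgeWeight_union_le [DecidableEq G.edgeSet] (w : Weights G) (F F' : Finset G.edgeSet) :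
    edgeWeight w (F ∪ F') ≤ edgeWeight w F + edgeWeight w F' := by
  have h := Finset.sum_union_inter (s₁ := F) (s₂ := F') (f := fun e => (w e : ℝ))
  have := edgeWeight_nonneg w (F ∩ F')
  unfold edgeWeight at *
  linarith

/-- The real-valued shortest path distance, as a minimum over connecting sets of edges
(and `0` if there is none). -/
noncomputable def rdist (w : Weights G) (a b : V) : ℝ :=
  ⨅ F : {F : Finset G.edgeSet // Joins (pairs F) a b}, edgeWeight w F

theorem rdist_nonneg (w : Weights G) (a b : V) : 0 ≤ rdist w a b :=
  Real.iInf_nonneg fun F => edgeWeight_nonneg w F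

theorem measurable_edgeWeight (F : Finset G.edgeSet) :
    Measurable fun w : Weights G => edgeWeight w F :=
  Finset.measurable_sum _ fun e _ => (measurable_pi_apply e).coe_nnreal_real

theorem wdist_eq_top (w : Weights G) {a b : V} (h : ¬ G.Reachable a b) : wdist w a b = ⊤ := by
  have : IsEmpty (G.Path a b) := ⟨fun p => h ⟨p.1⟩⟩
  exact iInf_of_empty _

theorem walkWeight_append (w : Weights G) {a b c : V} (p : G.Walk a b) (q : G.Walk b c) :
    walkWeight w (p.append q) = walkWeight w p + walkWeight w q := by
  induction p with
  | nil => simp [walkWeight]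
  | cons h p ih => simp [walkWeight, ih, add_assoc]

theorem rdist_comm (w : Weights G) (a b : V) : rdist w a b = rdist w b a := by
  have h : ∀ F : Finset G.edgeSet, Joins (pairs F) a b ↔ Joins (pairs F) b a :=
    fun F => ⟨Joins.symm, Joins.symm⟩
  exact (Equiv.subtypeEquivRight h).iInf_congr fun _ => rfl

variable [Fintype G.edgeSet]

theorem edgeWeight_sub_le (w w' : Weights G) (h : Neighbors w w') (F : Finset G.edgeSet) :
    edgeWeight w F ≤ edgeWeight w' F + 1 := by
  have h1 : edgeWeight w F - edgeWeight w' F ≤ ∑ e ∈ F, |(w e : ℝ) - w' e| := by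
    rw [edgeWeight, edgeWeight, ← Finset.sum_sub_distrib]
    exact Finset.sum_le_sum fun e _ => le_abs_self _
  have h2 : ∑ e ∈ F, |(w e : ℝ) - w' e| ≤ ∑ e, |(w e : ℝ) - w' e| :=
    Finset.sum_le_univ_sum_of_nonneg fun e => abs_nonneg _
  unfold Neighbors at h
  linarith

theorem rdist_le (w : Weights G) {a b : V} {F : Finset G.edgeSet} (h : Joins (pairs F) a b) :
    rdist w a b ≤ edgeWeight w F :=
  ciInf_le (Set.finite_range _).bddBelow (⟨F, h⟩ : {F : Finset G.edgeSet // Joins (pairs F) a b})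

theorem nonempty_joins {a b : V} (h : G.Reachable a b) :
    Nonempty {F : Finset G.edgeSet // Joins (pairs F) a b} := by
  obtain ⟨p⟩ := h
  exact ⟨Finset.univ, Joins.of_walk p fun _ he =>
    mem_pairs.mpr ⟨p.edges_subset_edgeSet he, Finset.mem_univ _⟩⟩

theorem exists_edgeWeight_eq_rdist (w : Weights G) {a b : V} (h : G.Reachable a b) :
    ∃ F : Finset G.edgeSet, Joins (pairs F) a b ∧ edgeWeight w F = rdist w a b := by
  have := nonempty_joins h
  obtain ⟨F, hF⟩ := exists_eq_ciInf_of_finite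
    (f := fun F : {F : Finset G.edgeSet // Joins (pairs F) a b} => edgeWeight w F)
  exact ⟨F, F.2, hF⟩

theorem rdist_sub_le (w w' : Weights G) (h : Neighbors w w') (a b : V) :
    rdist w a b ≤ rdist w' a b + 1 := by
  by_cases hr : G.Reachable a b
  · obtain ⟨F, hF, hw⟩ := exists_edgeWeight_eq_rdist w' hr
    have := rdist_le w hF
    have := edgeWeight_sub_le w w' h F
    linarith
  -- For unreachable pairs both distances take the default value `0`.
  · have : IsEmpty {F : Finset G.edgeSet // Joins (pairs F) a b} :=
      ⟨fun F => hr F.2.reachable⟩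
    simp [rdist, Real.iInf_of_isEmpty]

theorem Neighbors.symm {w w' : Weights G} (h : Neighbors w w') : Neighbors w' w := by
  unfold Neighbors at *
  simpa only [abs_sub_comm] using h

theorem measurable_rdist (a b : V) : Measurable fun w : Weights G => rdist w a b :=
  Measurable.iInf fun F => measurable_edgeWeight F.1

open Classical in
/-- The set of edges of a walk. -/
noncomputable def walkEdges {a b : V} (p : G.Walk a b) : Finset G.edgeSet :=
  Finset.univ.filter fun e => (e : Sym2 V) ∈ p.edges

theorem mem_walkEdges {a b : V} {p : G.Walk a b} {e : G.edgeSet} :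
    e ∈ walkEdges p ↔ (e : Sym2 V) ∈ p.edges := by
  simp [walkEdges]

theorem joins_walkEdges {a b : V} (p : G.Walk a b) : Joins (pairs (walkEdges p)) a b :=
  Joins.of_walk p fun _ he => mem_pairs.mpr ⟨p.edges_subset_edgeSet he, mem_walkEdges.mpr he⟩

theorem card_walkEdges_le {a b : V} (p : G.Walk a b) : (walkEdges p).card ≤ p.length := by
  classical
  rw [← Walk.length_edges]
  refine le_trans ?_ (List.toFinset_card_le p.edges)
  refine Finset.card_le_card_of_injOn (fun e => (e : Sym2 V)) ?_ Subtype.val_injective.injOn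
  intro e he
  simpa using mem_walkEdges.mp he

theorem walkWeight_eq_edgeWeight (w : Weights G) {a b : V} (p : G.Walk a b)
    (hp : p.edges.Nodup) : (walkWeight w p : ℝ) = edgeWeight w (walkEdges p) := by
  classical
  induction p with
  | nil => simp [walkWeight, edgeWeight, walkEdges]
  | cons h q ih =>
    rw [Walk.edges_cons, List.nodup_cons] at hp
    have h1 : walkEdges (.cons h q) = insert ⟨_, G.mem_edgeSet.mpr h⟩ (walkEdges q) := by
      ext e
      simp [mem_walkEdges, Subtype.ext_iff]
    have h2 : (⟨_, G.mem_edgeSet.mpr h⟩ : G.edgeSet) ∉ walkEdges q := by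
      rw [mem_walkEdges]; exact hp.1
    rw [walkWeight, h1, edgeWeight, Finset.sum_insert h2, NNReal.coe_add, ih hp.2, edgeWeight]

theorem exists_path_le_edgeWeight (w : Weights G) {a b : V} {F : Finset G.edgeSet}
    (h : Joins (pairs F) a b) :
    ∃ p : G.Path a b, (walkWeight w (p : G.Walk a b) : ℝ) ≤ edgeWeight w F := by
  classical
  obtain ⟨q⟩ := h
  have hle : fromEdgeSet (pairs F) ≤ G := fun x y hxy =>
    (mem_pairs.mp ((fromEdgeSet_adj _).mp hxy).1).1
  have hpath : (q.bypass.mapLe hle).IsPath := by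
    rw [Walk.isPath_mapLe]
    exact q.bypass_isPath
  refine ⟨⟨_, hpath⟩, ?_⟩
  rw [walkWeight_eq_edgeWeight w _ hpath.isTrail.edges_nodup]
  refine edgeWeight_mono w fun e he => ?_
  rw [mem_walkEdges, Walk.edges_mapLe_eq_edges] at he
  have := q.bypass.edges_subset_edgeSet he
  rw [edgeSet_fromEdgeSet] at this
  obtain ⟨_, h⟩ := mem_pairs.mp this.1
  exact h

theorem rdist_le_walkWeight (w : Weights G) {a b : V} {p : G.Walk a b} (hp : p.IsPath) :
    rdist w a b ≤ walkWeight w p := by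
  rw [walkWeight_eq_edgeWeight w p hp.isTrail.edges_nodup]
  exact rdist_le w (joins_walkEdges p)

theorem exists_path_eq_rdist (w : Weights G) {a b : V} (h : G.Reachable a b) :
    ∃ p : G.Path a b, (walkWeight w (p : G.Walk a b) : ℝ) = rdist w a b := by
  obtain ⟨F, hF, hw⟩ := exists_edgeWeight_eq_rdist w h
  obtain ⟨p, hp⟩ := exists_path_le_edgeWeight w hF
  exact ⟨p, le_antisymm (hp.trans hw.le) (rdist_le_walkWeight w p.2)⟩

theorem wdist_eq_rdist (w : Weights G) {a b : V} (h : G.Reachable a b) :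
    wdist w a b = (rdist w a b : EReal) := by
  refine le_antisymm ?_ (le_iInf fun p => EReal.coe_le_coe_iff.mpr (rdist_le_walkWeight w p.2))
  obtain ⟨p, hp⟩ := exists_path_eq_rdist w h
  exact (iInf_le _ p).trans (by rw [hp])

open Classical in
/-- Either a shortest path has at most `L` edges, or it has `L` distinct vertices reachable
along it within `L` edges. -/
theorem exists_prefix (w : Weights G) {a b : V} (h : G.Reachable a b) (L : ℕ) :
    (∃ F : Finset G.edgeSet, F.card ≤ L ∧ Joins (pairs F) a b ∧ edgeWeight w F ≤ rdist w a b) ∨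
    ∃ P : Finset V, L ≤ P.card ∧ ∀ x ∈ P, G.Reachable x b ∧ ∃ F : Finset G.edgeSet, F.card ≤ L ∧
      Joins (pairs F) a x ∧ edgeWeight w F + rdist w x b ≤ rdist w a b := by
  obtain ⟨⟨p, hp⟩, hpw⟩ := exists_path_eq_rdist w h
  dsimp only at hpw
  rcases le_total p.length L with hL | hL
  · refine Or.inl ⟨walkEdges p, (card_walkEdges_le p).trans hL, joins_walkEdges p, ?_⟩
    rw [← walkWeight_eq_edgeWeight w p hp.isTrail.edges_nodup, hpw]
  -- The first `L` vertices are distinct because `p` is a path with at least `L` edges.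
  · refine Or.inr ⟨(Finset.range L).image p.getVert, ?_, ?_⟩
    · rw [Finset.card_image_of_injOn, Finset.card_range]
      intro i hi j hj hij
      simp only [Finset.coe_range, Set.mem_Iio] at hi hj
      exact hp.getVert_injOn (show i ≤ p.length by omega) (show j ≤ p.length by omega) hij
    · intro x hx
      obtain ⟨i, hi, rfl⟩ := Finset.mem_image.mp hx
      rw [Finset.mem_range] at hi
      refine ⟨⟨p.drop i⟩, walkEdges (p.take i), ?_, joins_walkEdges _, ?_⟩
      · refine (card_walkEdges_le _).trans ?_
        rw [Walk.take_length]
        omega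
      · have hsplit : walkWeight w (p.take i) + walkWeight w (p.drop i) = walkWeight w p := by
          rw [← walkWeight_append, Walk.append_take_drop_eq]
        rw [← walkWeight_eq_edgeWeight w _ (hp.take i).isTrail.edges_nodup, ← hpw, ← hsplit]
        have := rdist_le_walkWeight w (hp.drop i)
        push_cast
        linarith

end Distance

/-! ### Routes with shortcuts: sensitivity and accuracy -/

section Routes

variable {V : Type u} {G : SimpleGraph V} {p : ℕ}

/-- The pairs of the shortcuts `h j`, for `j ∈ J`. -/
def shortcuts (h : Fin p → V × V) (J : Finset (Fin p)) : Set (Sym2 V) :=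
  {e | ∃ j ∈ J, s((h j).1, (h j).2) = e}

/-- A route: at most `2 * L` edges of the graph and fewer than `g` shortcuts that together
connect `a` to `b`. -/
abbrev Route (G : SimpleGraph V) (L g : ℕ) (h : Fin p → V × V) (a b : V) : Type u :=
  {r : Finset G.edgeSet × Finset (Fin p) // r.1.card ≤ 2 * L ∧ r.2.card < g ∧
    Joins (pairs r.1 ∪ shortcuts h r.2) a b}

/-- Shortcuts that join reachable pairs only, and leave no reachable pair without a route. -/
abbrev Candidate (G : SimpleGraph V) (p L g : ℕ) : Type u :=
  {h : Fin p → V × V // (∀ j, G.Reachable (h j).1 (h j).2) ∧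
    ∀ a b, G.Reachable a b → Nonempty (Route G L g h a b)}

/-- This count enters the union bound for the exponential mechanism. -/
theorem card_candidate_le [Fintype V] (L g : ℕ) :
    Nat.card (Candidate G p L g) ≤ Fintype.card V ^ (2 * p) := by
  have h := Nat.card_le_card_of_injective (α := Candidate G p L g) (β := Fin p → V × V)
    Subtype.val Subtype.val_injective
  refine h.trans (le_of_eq ?_)
  rw [Nat.card_eq_fintype_card, Fintype.card_fun, Fintype.card_prod, Fintype.card_fin, pow_mul,
    sq]

variable {L g : ℕ}

/-- The true cost of a route: the edges cost their weight, the shortcuts the distance. -/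
noncomputable def routeCost (w : Weights G) (h : Fin p → V × V) {a b : V}
    (r : Route G L g h a b) : ℝ :=
  edgeWeight w r.1.1 + ∑ j ∈ r.1.2, rdist w (h j).1 (h j).2

/-- The cost of the cheapest route (`0` if there is none). -/
noncomputable def detour (L g : ℕ) (w : Weights G) (h : Fin p → V × V) (a b : V) : ℝ :=
  ⨅ r : Route G L g h a b, routeCost w h r

variable [Fintype G.edgeSet]

-- Each shortcut is expanded into a cheapest edge set joining its ends; overlaps only lower the
-- total weight.
open Classical in
theorem exists_joins_of_route (w : Weights G) (h : Candidate G p L g) {a b : V}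
    (r : Route G L g h.1 a b) :
    ∃ F : Finset G.edgeSet, Joins (pairs F) a b ∧ edgeWeight w F ≤ routeCost w h.1 r := by
  obtain ⟨⟨F, J⟩, hF, hJ, hab⟩ := r
  choose f hf hfw using fun j => exists_edgeWeight_eq_rdist w (h.2.1 j)
  refine ⟨F ∪ J.biUnion f, hab.bind ?_, ?_⟩
  · intro x y hxy
    rcases hxy with hxy | ⟨j, hj, hxy⟩
    · exact Joins.of_mem (pairs_mono Finset.subset_union_left hxy)
    · have hj' := (hf j).mono (T' := pairs (F ∪ J.biUnion f))
        (pairs_mono ((Finset.subset_biUnion_of_mem f hj).trans Finset.subset_union_right))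
      rcases Sym2.eq_iff.mp hxy with ⟨rfl, rfl⟩ | ⟨rfl, rfl⟩
      · exact hj'
      · exact hj'.symm
  · refine (edgeWeight_union_le w _ _).trans (add_le_add_right ?_ _)
    simp only [← hfw]
    clear hab hJ hF
    induction J using Finset.induction_on with
    | empty => simp [edgeWeight]
    | insert j J hj ih =>
      rw [Finset.biUnion_insert, Finset.sum_insert hj]
      exact (edgeWeight_union_le w _ _).trans (add_le_add_right ih _)

theorem Route.reachable {h : Candidate G p L g} {a b : V} (r : Route G L g h.1 a b) :
    G.Reachable a b := by
  obtain ⟨F, hF, -⟩ := exists_joins_of_route 0 h r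
  exact hF.reachable

/-- This holds for every candidate, good or bad, so the lower side of the accuracy needs no bound on
the score. -/
theorem rdist_le_routeCost (w : Weights G) (h : Candidate G p L g) {a b : V}
    (r : Route G L g h.1 a b) : rdist w a b ≤ routeCost w h.1 r := by
  obtain ⟨F, hF, hw⟩ := exists_joins_of_route w h r
  exact (rdist_le w hF).trans hw

theorem detour_le (w : Weights G) (h : Fin p → V × V) {a b : V} (r : Route G L g h a b) :
    detour L g w h a b ≤ routeCost w h r :=
  ciInf_le (Set.finite_range _).bddBelow r

/-- The set of routes does not depend on the weights. On a fixed route, all edges together change by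
at most `1`, and so does each of its fewer than `g` shortcuts. -/
theorem detour_sub_le (w w' : Weights G) (hw : Neighbors w w') (h : Fin p → V × V) (a b : V) :
    detour L g w h a b ≤ detour L g w' h a b + (1 + g) := by
  rcases isEmpty_or_nonempty (Route G L g h a b) with he | he
  · simp only [detour, Real.iInf_of_isEmpty]
    positivity
  · obtain ⟨r, hr⟩ := exists_eq_ciInf_of_finite (f := fun r : Route G L g h a b =>
      routeCost w' h r)
    have h1 := detour_le w h r
    have h2 := edgeWeight_sub_le w w' hw r.1.1
    have h3 : ∑ j ∈ r.1.2, rdist w (h j).1 (h j).2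
        ≤ ∑ j ∈ r.1.2, (rdist w' (h j).1 (h j).2 + 1) :=
      Finset.sum_le_sum fun j _ => rdist_sub_le w w' hw _ _
    rw [Finset.sum_add_distrib, Finset.sum_const, nsmul_eq_mul, mul_one] at h3
    have h4 : (r.1.2.card : ℝ) ≤ g := by exact_mod_cast r.2.2.1.le
    change routeCost w' h r = detour L g w' h a b at hr
    rw [← hr]
    unfold routeCost at *
    linarith

/-- How much the routes of `h` exceed the stretch `2 * k - 1`. -/
noncomputable def score (L k : ℕ) (w : Weights G) (h : Fin p → V × V) : ℝ :=
  ⨆ q : V × V, max 0 (detour L (2 * k) w h q.1 q.2 - (2 * (k : ℝ) - 1) * rdist w q.1 q.2)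

variable {k : ℕ}

omit [Fintype G.edgeSet] in
theorem score_nonneg (w : Weights G) (h : Fin p → V × V) : 0 ≤ score L k w h :=
  Real.iSup_nonneg fun _ => le_max_left _ _

omit [Fintype G.edgeSet] in
theorem detour_le_score [Finite V] (w : Weights G) (h : Fin p → V × V) (a b : V) :
    detour L (2 * k) w h a b ≤ (2 * (k : ℝ) - 1) * rdist w a b + score L k w h := by
  have h1 : max 0 (detour L (2 * k) w h a b - (2 * (k : ℝ) - 1) * rdist w a b)
      ≤ score L k w h :=
    le_ciSup (f := fun q : V × V =>
      max 0 (detour L (2 * k) w h q.1 q.2 - (2 * (k : ℝ) - 1) * rdist w q.1 q.2))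
      (Set.finite_range _).bddAbove (a, b)
  linarith [le_max_right 0 (detour L (2 * k) w h a b - (2 * (k : ℝ) - 1) * rdist w a b)]

/-- The detour contributes `1 + 2k` and the multiple of the distance contributes `2k - 1`. -/
theorem score_sub_le [Finite V] (hk : 1 ≤ k) (w w' : Weights G) (hw : Neighbors w w')
    (h : Fin p → V × V) : score L k w h ≤ score L k w' h + 4 * k := by
  have hk' : (1 : ℝ) ≤ k := by exact_mod_cast hk
  have h0 := score_nonneg (L := L) (k := k) w' h
  refine Real.iSup_le (fun q => max_le (by positivity) ?_) (by positivity)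
  have h1 := detour_sub_le (L := L) (g := 2 * k) w w' hw h q.1 q.2
  have h2 := rdist_sub_le w' w hw.symm q.1 q.2
  have h3 := detour_le_score (L := L) (k := k) w' h q.1 q.2
  have h4 := mul_le_mul_of_nonneg_left h2 (by linarith : (0 : ℝ) ≤ 2 * k - 1)
  push_cast at h1
  linarith

theorem measurable_score [Finite V] (h : Fin p → V × V) :
    Measurable fun w : Weights G => score L k w h := by
  refine Measurable.iSup fun q => measurable_const.max (Measurable.sub ?_
    ((measurable_rdist _ _).const_mul _))
  refine Measurable.iInf fun r => (measurable_edgeWeight _).add ?_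
  exact Finset.measurable_sum _ fun j _ => measurable_rdist _ _

/-- The table of estimates read off from the noisy weights `y` and shortcut lengths `z`. -/
noncomputable def estimate (L g : ℕ) (h : Fin p → V × V) (y : G.edgeSet → ℝ) (z : Fin p → ℝ) :
    Estimates V := fun a b =>
  ⨅ r : Route G L g h a b, ((∑ e ∈ r.1.1, y e + ∑ j ∈ r.1.2, z j : ℝ) : EReal)

theorem abs_sum_sub_sum_le {ι : Type*} (s : Finset ι) (f f' : ι → ℝ) {t c : ℝ}
    (hs : (s.card : ℝ) ≤ c) (ht : 0 ≤ t) (h : ∀ i, |f i - f' i| ≤ t) :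
    |∑ i ∈ s, f i - ∑ i ∈ s, f' i| ≤ c * t := by
  rw [← Finset.sum_sub_distrib]
  refine (Finset.abs_sum_le_sum_abs _ _).trans ((Finset.sum_le_sum fun i _ => h i).trans ?_)
  rw [Finset.sum_const, nsmul_eq_mul]
  exact mul_le_mul_of_nonneg_right hs ht

/-- Every noisy route cost is within `2 * L * s + 2 * k * t` of the true one. True costs are at
least the distance, and the cheapest exceeds the stretch by at most the score. -/
theorem isAccurate_estimate [Finite V] (hk : 1 ≤ k) (w : Weights G)
    (h : Candidate G p L (2 * k)) (y : G.edgeSet → ℝ) (z : Fin p → ℝ) {s t τ α : ℝ}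
    (hs : 0 ≤ s) (ht : 0 ≤ t)
    (hy : ∀ e, |y e - w e| ≤ s) (hz : ∀ j, |z j - rdist w (h.1 j).1 (h.1 j).2| ≤ t)
    (hτ : score L k w h.1 ≤ τ) (hα : τ + 2 * L * s + 2 * k * t ≤ α) :
    IsAccurate w (2 * (k : ℝ) - 1) α (estimate L (2 * k) h.1 y z) := by
  have hk' : (1 : ℝ) ≤ k := by exact_mod_cast hk
  have hτ0 := (score_nonneg w h.1).trans hτ
  have key : ∀ a b (r : Route G L (2 * k) h.1 a b),
      |(∑ e ∈ r.1.1, y e + ∑ j ∈ r.1.2, z j) - routeCost w h.1 r|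
        ≤ 2 * L * s + 2 * k * t := by
    intro a b r
    have h1 := abs_sum_sub_sum_le r.1.1 y (fun e => (w e : ℝ)) (c := 2 * L) (t := s)
      (by exact_mod_cast r.2.1) hs hy
    have h2 := abs_sum_sub_sum_le r.1.2 z (fun j => rdist w (h.1 j).1 (h.1 j).2)
      (c := 2 * k) (t := t) (by exact_mod_cast r.2.2.1.le) ht hz
    rw [abs_le] at *
    unfold routeCost edgeWeight
    constructor <;> linarith [h1.1, h1.2, h2.1, h2.2]
  intro a b
  by_cases hab : G.Reachable a b
  · rw [wdist_eq_rdist w hab]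
    constructor
    · refine le_iInf fun r => ?_
      rw [← EReal.coe_sub, EReal.coe_le_coe_iff]
      have h1 := rdist_le_routeCost w h r
      have h2 := (abs_le.mp (key a b r)).1
      linarith
    · have := h.2.2 a b hab
      obtain ⟨r, hr⟩ := exists_eq_ciInf_of_finite
        (f := fun r : Route G L (2 * k) h.1 a b => routeCost w h.1 r)
      refine (iInf_le _ r).trans ?_
      rw [← EReal.coe_mul, ← EReal.coe_add, EReal.coe_le_coe_iff]
      have h1 := detour_le_score (L := L) (k := k) w h.1 a b
      change routeCost w h.1 r = detour L (2 * k) w h.1 a b at hr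
      rw [← hr] at h1
      have h2 := (abs_le.mp (key a b r)).2
      linarith
  -- Candidates shortcut reachable pairs only, so an unreachable pair has no route and its estimate
  -- is the empty infimum `⊤`, which is exact.
  · have : IsEmpty (Route G L (2 * k) h.1 a b) := ⟨fun r => hab r.reachable⟩
    rw [wdist_eq_top w hab, EReal.coe_mul_top_of_pos (by linarith), estimate, iInf_of_empty]
    exact ⟨le_top, by rw [EReal.top_add_coe]⟩

end Routes

/-! ### A good list of shortcuts exists -/

section Existence

variable {V : Type u} {G : SimpleGraph V}

/-- Candidates have exactly `p` entries, so the list is padded with trivial pairs `(v, v)`. -/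
theorem exists_enumeration {α : Type*} [Nonempty α] {p : ℕ} (T : Finset (Sym2 α))
    (hT : T.card ≤ p) : ∃ h : Fin p → α × α,
      (∀ j, s((h j).1, (h j).2) ∈ T ∨ (h j).1 = (h j).2) ∧
      ∀ e ∈ T, ∃ j, s((h j).1, (h j).2) = e := by
  classical
  have hout : ∀ e : Sym2 α, ∃ q : α × α, s(q.1, q.2) = e := fun e => by
    induction e with | _ x y => exact ⟨(x, y), rfl⟩
  choose f hf using hout
  obtain ⟨v⟩ := ‹Nonempty α›
  refine ⟨fun j => if hj : (j : ℕ) < T.card then f (T.equivFin.symm ⟨j, hj⟩) else (v, v),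
    fun j => ?_, fun e he => ?_⟩
  · by_cases hj : (j : ℕ) < T.card
    · simp only [hj, dite_true, hf]
      exact Or.inl (Subtype.property _)
    · simp [hj]
  · refine ⟨⟨T.equivFin ⟨e, he⟩, (T.equivFin ⟨e, he⟩).2.trans_le hT⟩, ?_⟩
    simp [hf]

theorem joins_of_walk_map {α : Type*} {H : SimpleGraph α} (f : α → V) {T : Set (Sym2 V)}
    {x y : α} (q : H.Walk x y) (hq : ∀ e ∈ q.edges, e.map f ∈ T) : Joins T (f x) (f y) := by
  induction q with
  | nil => exact Joins.refl T _
  | cons h q ih =>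
    simp only [Walk.edges_cons, List.mem_cons, forall_eq_or_imp] at hq
    exact (Joins.of_mem hq.1).trans (ih hq.2)

open Classical in
/-- Some few shortcuts between the points of a set `S` give bottleneck stretch on `S`. -/
theorem exists_shortcuts [Nonempty V] (w : Weights G) (S : Finset V) {k D p : ℕ} (hk : 1 ≤ k)
    (hp : 0 < p) (hD : S.card < D ^ k) (hDp : D * S.card ≤ p) :
    ∃ h : Fin p → V × V, (∀ j, G.Reachable (h j).1 (h j).2) ∧
      ∀ x ∈ S, ∀ y ∈ S, G.Reachable x y → ∃ J : Finset (Fin p), J.card < 2 * k ∧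
        Joins (shortcuts h J) x y ∧
        ∀ j ∈ J, rdist w (h j).1 (h j).2 ≤ rdist w x y := by
  have : Nonempty (Fin p) := ⟨⟨0, hp⟩⟩
  let wt : Sym2 V → ℝ := Sym2.lift ⟨fun x y => rdist w x y, rdist_comm w⟩
  let R : Set (Sym2 V) := Sym2.fromRel (r := G.Reachable) ⟨fun _ _ h => h.symm⟩
  -- The spanner is taken on the vertex set `S`, where the reachable pairs are weighted by their
  -- distance in `G`.
  obtain ⟨H, hHT, hH, hsp⟩ := exists_greedy_spanner (V := S) (fun e => wt (e.map (↑))) (2 * k)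
    (by omega) (Finset.univ.filter fun e => e.map (↑) ∈ R)
  have hcard : (H.edgeFinset.image (Sym2.map (Subtype.val : S → V))).card ≤ p := by
    refine Finset.card_image_le.trans ((hH.card_edgeFinset_le (D := D) (by simpa)).trans ?_)
    refine (Nat.mul_le_mul_left D ?_).trans hDp
    simpa using Set.ncard_le_card H.support
  obtain ⟨h, h1, h2⟩ := exists_enumeration _ hcard
  choose! idx hidx using h2
  refine ⟨h, fun j => ?_, fun x hx y hy hxy => ?_⟩
  · rcases h1 j with hj | hj
    · obtain ⟨e, he, heq⟩ := Finset.mem_image.mp hj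
      have := (Finset.mem_filter.mp (hHT (mem_edgeFinset.mp he))).2
      rw [heq] at this
      exact this
    · rw [hj]
  · by_cases hne : x = y
    · exact ⟨∅, by simp; omega, hne ▸ Joins.refl _ _, by simp⟩
    obtain ⟨q, hq, hqw⟩ := hsp ⟨x, hx⟩ ⟨y, hy⟩ (by simpa using hne) (by simpa [R] using hxy)
    have hmem : ∀ e ∈ q.edges, s((h (idx (e.map (↑)))).1, (h (idx (e.map (↑)))).2)
        = e.map (Subtype.val : S → V) := fun e he =>
      hidx _ (Finset.mem_image_of_mem _ (mem_edgeFinset.mpr (q.edges_subset_edgeSet he)))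
    refine ⟨q.edges.toFinset.image fun e => idx (e.map (↑)), ?_, ?_, ?_⟩
    · refine Finset.card_image_le.trans_lt ((List.toFinset_card_le _).trans_lt ?_)
      rwa [Walk.length_edges]
    · refine joins_of_walk_map Subtype.val q fun e he => ⟨idx (e.map (↑)), ?_, hmem e he⟩
      exact Finset.mem_image_of_mem _ (List.mem_toFinset.mpr he)
    · intro j hj
      obtain ⟨e, he, rfl⟩ := Finset.mem_image.mp hj
      rw [List.mem_toFinset] at he
      have h3 := hqw e he
      have h4 := congrArg wt (hmem e he)
      simp only [wt, Sym2.lift_mk, Sym2.map_mk] at h3 h4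
      exact h4.le.trans h3

-- The hitting set cuts a shortest path near `a` and then near `b`; the spanner bridges the gap
-- between the two cut points.
open Classical in
theorem exists_score_eq_zero [Fintype G.edgeSet] [Fintype V] [Nonempty V] (w : Weights G) {k D L m p : ℕ}
    (hk : 1 ≤ k) (hp : 0 < p) (hD : m < D ^ k) (hDp : D * m ≤ p)
    (hm : (Fintype.card V : ℝ) ^ 2 * Real.exp (-((m : ℝ) * L / Fintype.card V)) < 1) :
    ∃ h : Candidate G p L (2 * k), score L k w h.1 = 0 := by
  let I : Finset (V × V) := Finset.univ.filter fun q =>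
    ∃ P : Finset V, L ≤ P.card ∧ ∀ x ∈ P, G.Reachable x q.2 ∧ ∃ F : Finset G.edgeSet,
      F.card ≤ L ∧ Joins (pairs F) q.1 x ∧ edgeWeight w F + rdist w x q.2 ≤ rdist w q.1 q.2
  have hI : ∀ q ∈ I, ∃ P : Finset V, L ≤ P.card ∧ ∀ x ∈ P, G.Reachable x q.2 ∧
      ∃ F : Finset G.edgeSet, F.card ≤ L ∧ Joins (pairs F) q.1 x ∧
        edgeWeight w F + rdist w x q.2 ≤ rdist w q.1 q.2 :=
    fun q hq => (Finset.mem_filter.mp hq).2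
  choose! P hPL hP using hI
  obtain ⟨S, hSm, hS⟩ := exists_hittingSet L m I P hPL (by
    refine lt_of_le_of_lt (mul_le_mul_of_nonneg_right ?_ (Real.exp_nonneg _)) hm
    have : I.card ≤ Fintype.card V ^ 2 := by
      simpa [sq] using Finset.card_le_univ I
    exact_mod_cast this)
  have hlocal : ∀ a b, G.Reachable a b →
      (∃ F : Finset G.edgeSet, F.card ≤ L ∧ Joins (pairs F) a b ∧
        edgeWeight w F ≤ rdist w a b) ∨
      ∃ x ∈ S, G.Reachable x b ∧ ∃ F : Finset G.edgeSet, F.card ≤ L ∧ Joins (pairs F) a x ∧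
        edgeWeight w F + rdist w x b ≤ rdist w a b := by
    intro a b hab
    rcases exists_prefix w hab L with h | h
    · exact Or.inl h
    · have hmem : (a, b) ∈ I := Finset.mem_filter.mpr ⟨Finset.mem_univ _, h⟩
      obtain ⟨x, hx, hxP⟩ := hS _ hmem
      exact Or.inr ⟨x, hx, hP _ hmem x hxP⟩
  obtain ⟨h, hh, hJ⟩ := exists_shortcuts w S hk hp (hSm.trans_lt hD)
    ((Nat.mul_le_mul_left D hSm).trans hDp)
  have hk' : (1 : ℝ) ≤ k := by exact_mod_cast hk
  have hroute : ∀ a b, G.Reachable a b → ∃ r : Route G L (2 * k) h a b,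
      routeCost w h r ≤ (2 * (k : ℝ) - 1) * rdist w a b := by
    intro a b hab
    have hstretch : ∀ d : ℝ, 0 ≤ d → d ≤ (2 * (k : ℝ) - 1) * d := fun d hd => by nlinarith
    rcases hlocal a b hab with ⟨F, hF, hj, hw⟩ | ⟨x, hx, hxb, F, hF, hj, hw⟩
    · refine ⟨⟨(F, ∅), by simp only; omega, by simp; omega,
        hj.mono Set.subset_union_left⟩, ?_⟩
      simp only [routeCost, Finset.sum_empty, add_zero]
      exact hw.trans (hstretch _ (rdist_nonneg _ _ _))
    -- The second cut is made on a shortest path from `b` to `x`, not to `a`, so that the two pieces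
    -- and the gap add up to at most `rdist w a b`.
    · rcases hlocal b x hxb.symm with ⟨F', hF', hj', hw'⟩ | ⟨y, hy, hyx, F', hF', hj', hw'⟩
      · refine ⟨⟨(F ∪ F', ∅), ?_, by simp; omega,
          ((hj.mono (pairs_mono Finset.subset_union_left)).trans
            (hj'.mono (pairs_mono Finset.subset_union_right)).symm).mono
              Set.subset_union_left⟩, ?_⟩
        · exact (Finset.card_union_le _ _).trans (by omega)
        · simp only [routeCost, Finset.sum_empty, add_zero]
          have h1 := edgeWeight_union_le w F F'
          have h2 := hstretch _ (rdist_nonneg w a b)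
          rw [rdist_comm w b x] at hw'
          linarith
      · obtain ⟨J, hJc, hJj, hJw⟩ := hJ x hx y hy hyx.symm
        refine ⟨⟨(F ∪ F', J), ?_, hJc, ?_⟩, ?_⟩
        · exact (Finset.card_union_le _ _).trans (by omega)
        · have e1 := hj.mono (T' := pairs (F ∪ F') ∪ shortcuts h J)
            ((pairs_mono Finset.subset_union_left).trans Set.subset_union_left)
          have e2 := hj'.mono (T' := pairs (F ∪ F') ∪ shortcuts h J)
            ((pairs_mono Finset.subset_union_right).trans Set.subset_union_left)
          exact (e1.trans (hJj.mono Set.subset_union_right)).trans e2.symm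
        · simp only [routeCost]
          have h1 := edgeWeight_union_le w F F'
          -- Bottleneck stretch: at most `2k - 1` shortcuts, each no longer than `rdist w x y`.
          have h2 : ∑ j ∈ J, rdist w (h j).1 (h j).2 ≤ (2 * (k : ℝ) - 1) * rdist w x y := by
            refine (Finset.sum_le_card_nsmul J _ _ hJw).trans ?_
            rw [nsmul_eq_mul]
            refine mul_le_mul_of_nonneg_right ?_ (rdist_nonneg _ _ _)
            have : J.card + 1 ≤ 2 * k := hJc
            have : ((J.card + 1 : ℕ) : ℝ) ≤ (2 * k : ℕ) := by exact_mod_cast this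
            push_cast at this
            linarith
          have h3 := hstretch _ (edgeWeight_nonneg w F)
          have h4 := hstretch _ (edgeWeight_nonneg w F')
          rw [rdist_comm w b x, rdist_comm w y x] at hw'
          have h5 : edgeWeight w F + edgeWeight w F' + rdist w x y ≤ rdist w a b := by linarith
          have h6 := mul_le_mul_of_nonneg_left h5 (by linarith : (0 : ℝ) ≤ 2 * k - 1)
          linarith
  let h' : Candidate G p L (2 * k) := ⟨h, hh, fun a b hab => ⟨(hroute a b hab).choose⟩⟩
  refine ⟨h', le_antisymm (Real.iSup_le (fun q => max_le le_rfl ?_) le_rfl) (score_nonneg _ _)⟩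
  by_cases hq : G.Reachable q.1 q.2
  · obtain ⟨r, hr⟩ := hroute q.1 q.2 hq
    have := detour_le w h r
    change detour L (2 * k) w h q.1 q.2 - _ ≤ 0
    linarith
  · have : IsEmpty (Route G L (2 * k) h'.1 q.1 q.2) := ⟨fun r => hq r.reachable⟩
    have h1 := mul_nonneg (by linarith : (0 : ℝ) ≤ 2 * k - 1) (rdist_nonneg w q.1 q.2)
    rw [detour, Real.iInf_of_isEmpty]
    linarith

end Existence

/-! ### Product Laplace measures -/

section Laplace

variable {ι : Type*} [Fintype ι]

/-- The density of independent Laplace variables with centers `a i` and rates `c i`. -/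
noncomputable def laplaceDensity (c a x : ι → ℝ) : ℝ :=
  ∏ i, c i / 2 * Real.exp (-(c i * |x i - a i|))

/-- The law of independent Laplace variables with centers `a i` and rates `c i`. -/
noncomputable def laplaceMeasure (c a : ι → ℝ) : Measure (ι → ℝ) :=
  volume.withDensity fun x => ENNReal.ofReal (laplaceDensity c a x)

theorem laplaceDensity_nonneg {c : ι → ℝ} (hc : ∀ i, 0 < c i) (a x : ι → ℝ) :
    0 ≤ laplaceDensity c a x :=
  Finset.prod_nonneg fun i _ => mul_nonneg (half_pos (hc i)).le (Real.exp_nonneg _)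

theorem measurable_laplaceDensity (c : ι → ℝ) :
    Measurable fun q : (ι → ℝ) × (ι → ℝ) => laplaceDensity c q.1 q.2 := by
  unfold laplaceDensity
  fun_prop

theorem integral_laplace {c : ℝ} (hc : 0 < c) (a : ℝ) :
    ∫ x : ℝ, c / 2 * Real.exp (-(c * |x - a|)) = 1 := by
  rw [integral_sub_right_eq_self (fun x => c / 2 * Real.exp (-(c * |x|))) a,
    integral_comp_abs (f := fun x => c / 2 * Real.exp (-(c * x))), integral_const_mul]
  have h := integral_exp_mul_Ioi (a := -c) (by linarith) 0
  simp only [neg_mul, mul_zero, Real.exp_zero] at h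
  rw [h]
  field_simp

theorem laplaceMeasure_univ {c : ι → ℝ} (hc : ∀ i, 0 < c i) (a : ι → ℝ) :
    laplaceMeasure c a Set.univ = 1 := by
  have h1 : ∀ i, Integrable fun x : ℝ => c i / 2 * Real.exp (-(c i * |x - a i|)) := fun i =>
    Integrable.of_integral_ne_zero (by rw [integral_laplace (hc i)]; exact one_ne_zero)
  have h2 : Integrable (laplaceDensity c a) :=
    Integrable.fintype_prod (f := fun i x => c i / 2 * Real.exp (-(c i * |x - a i|))) h1
  rw [laplaceMeasure, withDensity_apply _ MeasurableSet.univ, Measure.restrict_univ,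
    ← ofReal_integral_eq_lintegral_ofReal h2
      (Filter.Eventually.of_forall (laplaceDensity_nonneg hc a))]
  have h3 : ∫ x, laplaceDensity c a x = ∏ i, ∫ x : ℝ, c i / 2 * Real.exp (-(c i * |x - a i|)) :=
    integral_fintype_prod_volume_eq_prod
      (fun i x => c i / 2 * Real.exp (-(c i * |x - a i|)))
  rw [h3]
  simp [integral_laplace (hc _)]

theorem laplaceDensity_le {c : ι → ℝ} (hc : ∀ i, 0 < c i) (a a' x : ι → ℝ) {A : ℝ}
    (hA : ∑ i, c i * |a i - a' i| ≤ A) :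
    laplaceDensity c a x ≤ Real.exp A * laplaceDensity c a' x := by
  have h1 : laplaceDensity c a x ≤
      ∏ i, (Real.exp (c i * |a i - a' i|) * (c i / 2 * Real.exp (-(c i * |x i - a' i|)))) := by
    refine Finset.prod_le_prod
      (fun i _ => mul_nonneg (half_pos (hc i)).le (Real.exp_nonneg _)) fun i _ => ?_
    rw [mul_left_comm, ← Real.exp_add]
    refine mul_le_mul_of_nonneg_left (Real.exp_le_exp.mpr ?_) (half_pos (hc i)).le
    have h2 : |x i - a' i| ≤ |x i - a i| + |a i - a' i| := abs_sub_le _ _ _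
    have h3 := mul_le_mul_of_nonneg_left h2 (hc i).le
    linarith
  rw [Finset.prod_mul_distrib, ← Real.exp_sum] at h1
  exact h1.trans (mul_le_mul_of_nonneg_right (Real.exp_le_exp.mpr hA)
    (laplaceDensity_nonneg hc a' x))

theorem laplaceMeasure_le {c : ι → ℝ} (hc : ∀ i, 0 < c i) (a a' : ι → ℝ) {A : ℝ}
    (hA : ∑ i, c i * |a i - a' i| ≤ A) {S : Set (ι → ℝ)} (hS : MeasurableSet S) :
    laplaceMeasure c a S ≤ ENNReal.ofReal (Real.exp A) * laplaceMeasure c a' S := by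
  rw [laplaceMeasure, laplaceMeasure, withDensity_apply _ hS, withDensity_apply _ hS,
    ← lintegral_const_mul' _ _ ENNReal.ofReal_ne_top]
  refine lintegral_mono fun x => ?_
  rw [← ENNReal.ofReal_mul (Real.exp_nonneg _)]
  exact ENNReal.ofReal_le_ofReal (laplaceDensity_le hc a a' x hA)

-- On the tail event, half of the exponent in coordinate `i` is worth the factor `exp (-(c i * t /
-- 2))`. What remains is twice the density with rate `c i / 2` in that coordinate, which again has
-- total mass `1`.
open Classical in
theorem laplaceMeasure_tail_le {c : ι → ℝ} (hc : ∀ i, 0 < c i) (a : ι → ℝ) (i : ι) (t : ℝ) :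
    laplaceMeasure c a {x | t < |x i - a i|} ≤ ENNReal.ofReal (2 * Real.exp (-(c i * t / 2))) := by
  have hS : MeasurableSet {x : ι → ℝ | t < |x i - a i|} :=
    measurableSet_lt measurable_const (by fun_prop)
  set c' := Function.update c i (c i / 2) with hc'
  have hc'pos : ∀ j, 0 < c' j := by
    intro j
    by_cases hj : j = i
    · subst hj; simpa [hc'] using hc j
    · simpa [hc', hj] using hc j
  have key : ∀ x ∈ {x : ι → ℝ | t < |x i - a i|},
      laplaceDensity c a x ≤ 2 * Real.exp (-(c i * t / 2)) * laplaceDensity c' a x := by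
    intro x hx
    have hx' : t < |x i - a i| := hx
    unfold laplaceDensity
    rw [← Finset.mul_prod_erase _ _ (Finset.mem_univ i),
      ← Finset.mul_prod_erase Finset.univ
        (fun j => c' j / 2 * Real.exp (-(c' j * |x j - a j|))) (Finset.mem_univ i), ← mul_assoc]
    have h1 : ∏ j ∈ Finset.univ.erase i, c' j / 2 * Real.exp (-(c' j * |x j - a j|))
        = ∏ j ∈ Finset.univ.erase i, c j / 2 * Real.exp (-(c j * |x j - a j|)) := by
      refine Finset.prod_congr rfl fun j hj => ?_
      rw [hc', Function.update_of_ne (Finset.ne_of_mem_erase hj)]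
    rw [h1]
    refine mul_le_mul_of_nonneg_right ?_
      (Finset.prod_nonneg fun j _ => mul_nonneg (half_pos (hc j)).le (Real.exp_nonneg _))
    have h2 : c' i = c i / 2 := by simp [hc']
    rw [h2]
    calc c i / 2 * Real.exp (-(c i * |x i - a i|))
        ≤ c i / 2 * Real.exp (-(c i * t / 2) + -(c i / 2 * |x i - a i|)) := by
          refine mul_le_mul_of_nonneg_left (Real.exp_le_exp.mpr ?_) (half_pos (hc i)).le
          have := mul_le_mul_of_nonneg_left hx'.le (half_pos (hc i)).le
          linarith
      _ = _ := by rw [Real.exp_add]; ring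
  have h0 : (0 : ℝ) ≤ 2 * Real.exp (-(c i * t / 2)) := by positivity
  calc laplaceMeasure c a {x | t < |x i - a i|}
      ≤ ENNReal.ofReal (2 * Real.exp (-(c i * t / 2)))
          * laplaceMeasure c' a {x | t < |x i - a i|} := by
        rw [laplaceMeasure, laplaceMeasure, withDensity_apply _ hS, withDensity_apply _ hS,
          ← lintegral_const_mul' _ _ ENNReal.ofReal_ne_top]
        refine setLIntegral_mono' hS fun x hx => ?_
        rw [← ENNReal.ofReal_mul h0]
        exact ENNReal.ofReal_le_ofReal (key x hx)
    _ ≤ ENNReal.ofReal (2 * Real.exp (-(c i * t / 2))) * laplaceMeasure c' a Set.univ := by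
        gcongr
        exact Set.subset_univ _
    _ = _ := by rw [laplaceMeasure_univ hc'pos, mul_one]

end Laplace

/-! ### The exponential mechanism combined with Laplace noise -/

section Mechanism

/-- The probability that the exponential mechanism with scores `s` selects `h`. -/
noncomputable def expProb {H : Type*} [Fintype H] (s : H → ℝ) (h : H) : ℝ :=
  Real.exp (-s h) / ∑ h', Real.exp (-s h')

variable {H : Type*} [Fintype H]

theorem expProb_nonneg (s : H → ℝ) (h : H) : 0 ≤ expProb s h :=
  div_nonneg (Real.exp_nonneg _) (Finset.sum_nonneg fun _ _ => Real.exp_nonneg _)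

theorem sum_exp_pos [Nonempty H] (s : H → ℝ) : 0 < ∑ h, Real.exp (-s h) :=
  Finset.sum_pos (fun _ _ => Real.exp_pos _) Finset.univ_nonempty

theorem sum_expProb [Nonempty H] (s : H → ℝ) : ∑ h, expProb s h = 1 := by
  unfold expProb
  rw [← Finset.sum_div, div_self (sum_exp_pos s).ne']

/-- One factor `exp B` comes from the numerator and one from the normalizing sum. -/
theorem expProb_le [Nonempty H] (s s' : H → ℝ) {B : ℝ} (h₁ : ∀ h, s h ≤ s' h + B)
    (h₂ : ∀ h, s' h ≤ s h + B) (h : H) :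
    expProb s h ≤ Real.exp (2 * B) * expProb s' h := by
  have e1 : Real.exp (-s h) ≤ Real.exp B * Real.exp (-s' h) := by
    rw [← Real.exp_add]
    exact Real.exp_le_exp.mpr (by linarith [h₂ h])
  have e2 : ∑ h, Real.exp (-s' h) ≤ Real.exp B * ∑ h, Real.exp (-s h) := by
    rw [Finset.mul_sum]
    refine Finset.sum_le_sum fun h _ => ?_
    rw [← Real.exp_add]
    exact Real.exp_le_exp.mpr (by linarith [h₁ h])
  have p1 := sum_exp_pos s
  have p2 := sum_exp_pos s'
  unfold expProb
  rw [two_mul, Real.exp_add, ← mul_div_assoc, div_le_div_iff₀ p1 p2]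
  calc Real.exp (-s h) * ∑ h, Real.exp (-s' h)
      ≤ (Real.exp B * Real.exp (-s' h)) * (Real.exp B * ∑ h, Real.exp (-s h)) :=
        mul_le_mul e1 e2 p2.le (by positivity)
    _ = _ := by ring

/-- A candidate of score `0` alone makes the normalizing sum at least `1`. -/
theorem expProb_le_exp (s : H → ℝ) {h₀ : H} (h₀s : s h₀ = 0) (h : H) :
    expProb s h ≤ Real.exp (-s h) := by
  refine div_le_self (Real.exp_nonneg _) ?_
  have := Finset.single_le_sum (f := fun h => Real.exp (-s h))
    (fun h _ => Real.exp_nonneg _) (Finset.mem_univ h₀)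
  simpa [h₀s] using this

open Classical in
/-- The exponential mechanism followed by Laplace noise and postprocessing. -/
theorem exists_mechanism {W X ι : Type*} [MeasurableSpace W] [MeasurableSpace X] [Fintype ι]
    [Nonempty H] (N : W → W → Prop) (hN : ∀ w w', N w w' → N w' w)
    (c : ι → ℝ) (hc : ∀ i, 0 < c i)
    (a : W → H → ι → ℝ) (ha : ∀ h i, Measurable fun w => a w h i)
    (s : W → H → ℝ) (hs : ∀ h, Measurable fun w => s w h) (hmin : ∀ w, ∃ h, s w h = 0)
    (Φ : H → (ι → ℝ) → X) (hΦ : ∀ h, Measurable (Φ h)) (A B : ℝ)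
    (hA : ∀ w w', N w w' → ∀ h, ∑ i, c i * |a w h i - a w' h i| ≤ A)
    (hB : ∀ w w', N w w' → ∀ h, s w h ≤ s w' h + B) :
    ∃ M : Kernel W X, IsMarkovKernel M ∧
      (∀ w w', N w w' → ∀ S, MeasurableSet S →
        M w S ≤ ENNReal.ofReal (Real.exp (A + 2 * B)) * M w' S) ∧
      ∀ (w : W) (S : Set X), MeasurableSet S → ∀ (T : ℝ) (t : ι → ℝ),
        (∀ h x, s w h ≤ T → (∀ i, |x i - a w h i| ≤ t i) → Φ h x ∈ S) →
        1 - (Fintype.card H * Real.exp (-T) + ∑ i, 2 * Real.exp (-(c i * t i / 2)))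
          ≤ (M w).real S := by
  have hmeas : ∀ h, Measurable (Function.uncurry fun (w : W) (x : ι → ℝ) =>
      ENNReal.ofReal (expProb (s w) h) * ENNReal.ofReal (laplaceDensity c (a w h) x)) := by
    intro h
    change Measurable fun q : W × (ι → ℝ) =>
      ENNReal.ofReal (expProb (s q.1) h) * ENNReal.ofReal (laplaceDensity c (a q.1 h) q.2)
    have h1 : Measurable fun w => expProb (s w) h := by
      unfold expProb
      exact (hs h).neg.exp.div (Finset.measurable_sum _ fun h' _ => (hs h').neg.exp)
    have h2 : Measurable fun w => a w h := measurable_pi_iff.mpr (ha h)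
    exact (h1.comp measurable_fst).ennreal_ofReal.mul ((measurable_laplaceDensity c).comp
      ((h2.comp measurable_fst).prodMk measurable_snd)).ennreal_ofReal
  -- A mixture: `h` is drawn with probability `expProb (s w) h`, then noise is added around `a w h`
  -- and `Φ h` is applied. Only the output of `Φ h` is released.
  let M : Kernel W X := ∑ h, (Kernel.withDensity (Kernel.const W volume)
    (fun w x => ENNReal.ofReal (expProb (s w) h)
      * ENNReal.ofReal (laplaceDensity c (a w h) x))).map (Φ h)
  have hM : ∀ w S, MeasurableSet S → M w S =
      ∑ h, ENNReal.ofReal (expProb (s w) h) * laplaceMeasure c (a w h) (Φ h ⁻¹' S) := by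
    intro w S hS
    rw [Kernel.finsetSum_apply']
    refine Finset.sum_congr rfl fun h _ => ?_
    rw [Kernel.map_apply' _ (hΦ h) _ hS, Kernel.withDensity_apply' _ (hmeas h),
      Kernel.const_apply, laplaceMeasure, withDensity_apply _ (hΦ h hS),
      lintegral_const_mul' _ _ ENNReal.ofReal_ne_top]
  have hsum : ∀ w, ∑ h, ENNReal.ofReal (expProb (s w) h) = 1 := fun w => by
    rw [← ENNReal.ofReal_sum_of_nonneg fun h _ => expProb_nonneg _ h, sum_expProb,
      ENNReal.ofReal_one]
  have hprob : ∀ w, IsProbabilityMeasure (M w) := fun w => ⟨by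
    rw [hM w _ MeasurableSet.univ]
    simp only [Set.preimage_univ, laplaceMeasure_univ hc, mul_one]
    exact hsum w⟩
  refine ⟨M, ⟨hprob⟩, fun w w' hww S hS => ?_, fun w S hS T t hgood => ?_⟩
  · rw [hM w S hS, hM w' S hS, Finset.mul_sum]
    refine Finset.sum_le_sum fun h _ => ?_
    have h1 := ENNReal.ofReal_le_ofReal
      (expProb_le (s w) (s w') (hB w w' hww) (hB w' w (hN w w' hww)) h)
    rw [ENNReal.ofReal_mul (Real.exp_nonneg _)] at h1
    have h2 := laplaceMeasure_le hc (a w h) (a w' h) (hA w w' hww h) (hΦ h hS)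
    refine (mul_le_mul' h1 h2).trans (le_of_eq ?_)
    rw [Real.exp_add, ENNReal.ofReal_mul (Real.exp_nonneg _)]
    ring
  · obtain ⟨h₀, hh₀⟩ := hmin w
    have hprobw := hprob w
    have htail : ∀ h, s w h ≤ T → laplaceMeasure c (a w h) (Φ h ⁻¹' Sᶜ)
        ≤ ENNReal.ofReal (∑ i, 2 * Real.exp (-(c i * t i / 2))) := by
      intro h hh
      have hsub : Φ h ⁻¹' Sᶜ ⊆ ⋃ i ∈ (Finset.univ : Finset ι), {x | t i < |x i - a w h i|} := by
        intro x hx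
        by_contra hcon
        simp only [Finset.mem_univ, Set.iUnion_true, Set.mem_iUnion, Set.mem_ofPred_eq,
          not_exists, not_lt] at hcon
        exact hx (hgood h x hh hcon)
      refine (measure_mono hsub).trans ((measure_biUnion_finset_le _ _).trans ?_)
      rw [ENNReal.ofReal_sum_of_nonneg fun i _ => by positivity]
      exact Finset.sum_le_sum fun i _ => laplaceMeasure_tail_le hc _ i _
    have hbound : M w Sᶜ ≤ ENNReal.ofReal
        (Fintype.card H * Real.exp (-T) + ∑ i, 2 * Real.exp (-(c i * t i / 2))) := by
      rw [hM w _ hS.compl, ENNReal.ofReal_add (by positivity)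
        (Finset.sum_nonneg fun i _ => by positivity)]
      -- A candidate of score at most `T` fails only through the noise; any other is selected with
      -- probability at most `exp (-T)`.
      have hterm : ∀ h, ENNReal.ofReal (expProb (s w) h) *
          laplaceMeasure c (a w h) (Φ h ⁻¹' Sᶜ) ≤ ENNReal.ofReal (Real.exp (-T)) +
          ENNReal.ofReal (expProb (s w) h) *
            ENNReal.ofReal (∑ i, 2 * Real.exp (-(c i * t i / 2))) := by
        intro h
        rcases le_total (s w h) T with hh | hh
        · exact (mul_le_mul_right (htail h hh) _).trans le_add_self
        · refine le_trans ?_ le_self_add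
          have h1 : laplaceMeasure c (a w h) (Φ h ⁻¹' Sᶜ) ≤ 1 :=
            (measure_mono (Set.subset_univ _)).trans (laplaceMeasure_univ hc _).le
          refine (mul_le_mul_right h1 _).trans ?_
          rw [mul_one]
          refine ENNReal.ofReal_le_ofReal ((expProb_le_exp (s w) hh₀ h).trans ?_)
          exact Real.exp_le_exp.mpr (by linarith)
      refine (Finset.sum_le_sum fun h _ => hterm h).trans (le_of_eq ?_)
      rw [Finset.sum_add_distrib, ← Finset.sum_mul, hsum, one_mul, Finset.sum_const,
        Finset.card_univ, nsmul_eq_mul, ENNReal.ofReal_mul (Nat.cast_nonneg _),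
        ENNReal.ofReal_natCast]
    have h1 : (M w).real Sᶜ ≤
        Fintype.card H * Real.exp (-T) + ∑ i, 2 * Real.exp (-(c i * t i / 2)) :=
      ENNReal.toReal_le_of_le_ofReal (add_nonneg (by positivity)
        (Finset.sum_nonneg fun i _ => by positivity)) hbound
    rw [measureReal_compl hS, probReal_univ] at h1
    linarith

end Mechanism

/-! ### Choice of parameters and assembly -/

theorem exists_parameters {n k : ℕ} (hn : 3 ≤ n) (hk : 1 ≤ k) :
    ∃ L m D p : ℕ, 0 < p ∧ m < D ^ k ∧ D * m ≤ p ∧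
      (n : ℝ) ^ 2 * Real.exp (-((m : ℝ) * L / n)) < 1 ∧
      (p : ℝ) ≤ 32 * (n : ℝ) ^ (((k : ℝ) + 1) / (2 * (k : ℝ) + 1)) ∧
      (L : ℝ) ≤ 2 * (n : ℝ) ^ (((k : ℝ) + 1) / (2 * (k : ℝ) + 1)) * Real.log n := by
  have hn1 : (1 : ℝ) < n := by exact_mod_cast (by omega : 1 < n)
  have hn0 : (0 : ℝ) < n := by linarith
  have hk1 : (1 : ℝ) ≤ k := by exact_mod_cast hk
  have hk0 : (k : ℝ) ≠ 0 := by linarith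
  have hlog : 1 ≤ Real.log n := by
    rw [Real.le_log_iff_exp_le hn0]
    have h3 : (3 : ℝ) ≤ n := by exact_mod_cast hn
    linarith [Real.exp_one_lt_d9]
  set X : ℝ := (n : ℝ) ^ (((k : ℝ) + 1) / (2 * (k : ℝ) + 1)) with hX
  set Y : ℝ := (n : ℝ) ^ ((k : ℝ) / (2 * (k : ℝ) + 1)) with hY
  have hX1 : 1 ≤ X := Real.one_le_rpow hn1.le (by positivity)
  have hY1 : 1 ≤ Y := Real.one_le_rpow hn1.le (by positivity)
  have hXY : X * Y = n := by
    rw [hX, hY, ← Real.rpow_add hn0, ← add_div,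
      div_eq_one_iff_eq (by positivity) |>.mpr (by ring), Real.rpow_one]
  have hYX : Y ^ (1 + 1 / (k : ℝ)) = X := by
    rw [hX, hY, ← Real.rpow_mul hn0.le]
    congr 1
    field_simp
  -- Since `X * Y = n`, these choices give `m * L ≥ 3 n log n`, which beats the `n ^ 2` pairs to be
  -- hit. Since `Y ^ (1 + 1 / k) = X`, the spanner size `D * m` is of order `X`.
  set L := ⌈X * Real.log n⌉₊
  set m := ⌈3 * Y⌉₊
  -- The added `1` makes `m < D ^ k` strict, as the Moore bound requires.
  set D := ⌊(m : ℝ) ^ (1 / (k : ℝ))⌋₊ + 1 with hD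
  have hLlow : X * Real.log n ≤ L := Nat.le_ceil _
  have hLup : (L : ℝ) ≤ X * Real.log n + 1 := (Nat.ceil_lt_add_one (by positivity)).le
  have hmlow : 3 * Y ≤ m := Nat.le_ceil _
  have hmup : (m : ℝ) ≤ 3 * Y + 1 := (Nat.ceil_lt_add_one (by positivity)).le
  have hm1 : (1 : ℝ) ≤ m := by linarith
  have hm0 : 0 < m := by exact_mod_cast (by linarith : (0 : ℝ) < m)
  have hr1 : 1 ≤ (m : ℝ) ^ (1 / (k : ℝ)) := Real.one_le_rpow hm1 (by positivity)
  refine ⟨L, m, D, D * m, by positivity, ?_, le_rfl, ?_, ?_, ?_⟩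
  · have h1 : (m : ℝ) ^ (1 / (k : ℝ)) < D := by
      rw [hD]; push_cast; exact Nat.lt_floor_add_one _
    have h2 := pow_lt_pow_left₀ h1 (by positivity) (by omega : k ≠ 0)
    rw [← Real.rpow_natCast, ← Real.rpow_mul (by positivity), one_div_mul_cancel hk0,
      Real.rpow_one] at h2
    exact_mod_cast h2
  · have h1 : 3 * Real.log n ≤ (m : ℝ) * L / n := by
      rw [le_div_iff₀ hn0]
      calc 3 * Real.log n * n = (3 * Y) * (X * Real.log n) := by rw [← hXY]; ring
        _ ≤ m * L := mul_le_mul hmlow hLlow (by positivity) (by positivity)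
    have h2 : (n : ℝ) ^ 2 = Real.exp (2 * Real.log n) := by
      rw [two_mul, Real.exp_add, Real.exp_log hn0, sq]
    rw [h2, ← Real.exp_add, Real.exp_lt_one_iff]
    linarith
  · have h1 : (D : ℝ) ≤ 2 * (m : ℝ) ^ (1 / (k : ℝ)) := by
      have := Nat.floor_le (by positivity : 0 ≤ (m : ℝ) ^ (1 / (k : ℝ)))
      rw [hD]; push_cast; linarith
    push_cast
    calc (D : ℝ) * m ≤ 2 * (m : ℝ) ^ (1 / (k : ℝ)) * m :=
          mul_le_mul_of_nonneg_right h1 (by positivity)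
      _ = 2 * (m : ℝ) ^ (1 + 1 / (k : ℝ)) := by
          rw [Real.rpow_add (by positivity), Real.rpow_one]; ring
      _ ≤ 2 * (4 * Y) ^ (1 + 1 / (k : ℝ)) := by
          gcongr
          linarith
      _ = 2 * ((4 : ℝ) ^ (1 + 1 / (k : ℝ)) * X) := by
          rw [Real.mul_rpow (by norm_num) (by positivity), hYX]
      _ ≤ 2 * ((4 : ℝ) ^ (2 : ℝ) * X) := by
          gcongr
          · norm_num
          · have : 1 / (k : ℝ) ≤ 1 := by rw [div_le_one (by linarith)]; exact hk1
            linarith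
      _ = 32 * X := by norm_num; ring
  · nlinarith

theorem measurableSet_isAccurate {V : Type u} [Finite V] {G : SimpleGraph V} (w : Weights G)
    (γ α : ℝ) : MeasurableSet {d : Estimates V | IsAccurate w γ α d} := by
  simp only [IsAccurate, Set.ofPred_forall]
  refine MeasurableSet.iInter fun a => MeasurableSet.iInter fun b => ?_
  have h : Measurable fun d : Estimates V => d a b :=
    (measurable_pi_apply b).comp (measurable_pi_apply a)
  exact (measurableSet_le measurable_const h).inter (measurableSet_le h measurable_const)

theorem measurable_estimate {V : Type u} {G : SimpleGraph V} [Fintype G.edgeSet] {p : ℕ}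
    (L g : ℕ) (h : Fin p → V × V) : Measurable fun x : G.edgeSet ⊕ Fin p → ℝ =>
      estimate (G := G) L g h (fun e => x (.inl e)) (fun j => x (.inr j)) := by
  refine measurable_pi_iff.mpr fun a => measurable_pi_iff.mpr fun b => Measurable.iInf fun r => ?_
  have h1 : Measurable fun x : G.edgeSet ⊕ Fin p → ℝ =>
      ∑ e ∈ r.1.1, x (.inl e) + ∑ j ∈ r.1.2, x (.inr j) := by fun_prop
  exact h1.coe_real_ereal

theorem exists_kernel_of_card_le_two {V : Type u} [Fintype V] (G : SimpleGraph V)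
    [Fintype G.edgeSet] (hn : Fintype.card V ≤ 2) {C : ℝ} (hC : 2 ≤ C) {ε : ℝ} (hε : 0 < ε)
    (γ α : ℝ) : ∃ M : Kernel (Weights G) (Estimates V), IsMarkovKernel M ∧ IsDP M ε 0 ∧
      ∀ w, 1 - C / (Fintype.card V : ℝ) ≤ (M w).real {d | IsAccurate w γ α d} := by
  refine ⟨Kernel.const _ (Measure.dirac 0), inferInstance, fun w w' _ S _ => ?_, fun w => ?_⟩
  · simp only [Kernel.const_apply]
    refine le_add_right (le_mul_of_one_le_left' ?_)
    rw [← ENNReal.ofReal_one]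
    exact ENNReal.ofReal_le_ofReal (Real.one_le_exp hε.le)
  -- With no vertices `C / 0 = 0`, so probability `1` is required, but accuracy is vacuous. With one
  -- or two vertices the required probability is at most `0`.
  · rcases isEmpty_or_nonempty V with hV | hV
    · have : {d : Estimates V | IsAccurate w γ α d} = Set.univ :=
        Set.eq_univ_of_forall fun d a => hV.elim a
      rw [this]
      simp
    · have h1 : (0 : ℝ) < Fintype.card V := by exact_mod_cast Fintype.card_pos
      have h2 : (Fintype.card V : ℝ) ≤ 2 := by exact_mod_cast hn
      have h3 : 1 ≤ C / (Fintype.card V : ℝ) := by rw [le_div_iff₀ h1]; linarith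
      linarith [measureReal_nonneg (μ := Kernel.const (Weights G) (Measure.dirac 0) w)
        (s := {d : Estimates V | IsAccurate w γ α d})]

theorem card_edgeSet_le {V : Type u} [Fintype V] (G : SimpleGraph V) [Fintype G.edgeSet] :
    Fintype.card G.edgeSet ≤ Fintype.card V ^ 2 := by
  classical
  rw [← SimpleGraph.edgeFinset_card]
  refine G.card_edgeFinset_le_card_choose_two.trans ?_
  exact Nat.choose_le_pow _ _

theorem exists_kernel_of_three_le_card {V : Type u} [Fintype V] (G : SimpleGraph V)
    [Fintype G.edgeSet] (hn : 3 ≤ Fintype.card V) {k : ℕ} (hk : 1 ≤ k) {ε : ℝ} (hε : 0 < ε) :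
    ∃ M : Kernel (Weights G) (Estimates V), IsMarkovKernel M ∧ IsDP M ε 0 ∧
      ∀ w, 1 - 3000 / (Fintype.card V : ℝ) ≤
        (M w).real {d | IsAccurate w (2 * (k : ℝ) - 1)
          (3000 * ((k : ℝ) * (Fintype.card V : ℝ) ^ (((k : ℝ) + 1) / (2 * (k : ℝ) + 1)) *
            Real.log (Fintype.card V : ℝ) ^ 2 / ε)) d} := by
  classical
  obtain ⟨L, m, D, p, hp, hD, hDp, hhit, hpX, hLX⟩ := exists_parameters hn hk
  set n := Fintype.card V with hndef
  set X : ℝ := (n : ℝ) ^ (((k : ℝ) + 1) / (2 * (k : ℝ) + 1)) with hX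
  set l := Real.log n with hl
  have hn1 : (1 : ℝ) < n := by exact_mod_cast (by omega : 1 < n)
  have hn0 : (0 : ℝ) < n := by linarith
  have hk1 : (1 : ℝ) ≤ k := by exact_mod_cast hk
  have hp1 : (1 : ℝ) ≤ p := by exact_mod_cast hp
  have hlog : 1 ≤ l := by
    rw [hl, Real.le_log_iff_exp_le hn0]
    have h3 : (3 : ℝ) ≤ n := by exact_mod_cast hn
    linarith [Real.exp_one_lt_d9]
  have hX0 : 0 < X := Real.rpow_pos_of_pos hn0 _
  have hXn : X ≤ n := by
    calc X ≤ (n : ℝ) ^ (1 : ℝ) := Real.rpow_le_rpow_of_exponent_le hn1.le (by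
          rw [div_le_one (by positivity)]; linarith)
      _ = n := Real.rpow_one _
  have hexp : ∀ j : ℕ, Real.exp (-((j : ℝ) * l)) = ((n : ℝ) ^ j)⁻¹ := fun j => by
    rw [Real.exp_neg, Real.exp_nat_mul, hl, Real.exp_log hn0]
  have : Nonempty V := Fintype.card_pos_iff.mp (by omega)
  have hcand := fun w : Weights G => exists_score_eq_zero (L := L) w hk hp hD hDp hhit
  have : Nonempty (Candidate G p L (2 * k)) := ⟨(hcand 0).choose⟩
  let _ : Fintype (Candidate G p L (2 * k)) := Fintype.ofFinite _
  -- Neighbors differ by at most `1` in total over the edges, but by up to `1` on each of the `p`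
  -- shortcuts. Each group costs `ε / 6`.
  let c : G.edgeSet ⊕ Fin p → ℝ := Sum.elim (fun _ => ε / 6) (fun _ => ε / (6 * p))
  let a : Weights G → Candidate G p L (2 * k) → G.edgeSet ⊕ Fin p → ℝ := fun w h =>
    Sum.elim (fun e => (w e : ℝ)) (fun j => rdist w (h.1 j).1 (h.1 j).2)
  obtain ⟨M, hM, hdp, hacc⟩ := exists_mechanism (X := Estimates V) (Neighbors (G := G))
    (fun w w' h => h.symm) c
    (by rintro (e | j) <;> simp only [c, Sum.elim_inl, Sum.elim_inr] <;> positivity) a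
    (by
      rintro h (e | j)
      · exact (measurable_pi_apply e).coe_nnreal_real
      · exact measurable_rdist _ _)
    -- With sensitivity `4k` the scaled score moves by at most `ε / 3`, which costs `2ε / 3`;
    -- together with the noise this is `ε`.
    (fun w h => ε / (12 * k) * score L k w h.1) (fun h => (measurable_score h.1).const_mul _)
    (fun w => (hcand w).imp fun h hh => by simp [hh])
    (fun h x => estimate (G := G) L (2 * k) h.1 (fun e => x (.inl e)) (fun j => x (.inr j)))
    (fun h => measurable_estimate L (2 * k) h.1) (ε / 3) (ε / 3)
    (by
      intro w w' hw h
      rw [Fintype.sum_sum_type]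
      simp only [c, a, Sum.elim_inl, Sum.elim_inr, ← Finset.mul_sum]
      have h1 : ∑ j, |rdist w (h.1 j).1 (h.1 j).2 - rdist w' (h.1 j).1 (h.1 j).2| ≤ p := by
        have := Finset.sum_le_card_nsmul Finset.univ
          (fun j => |rdist w (h.1 j).1 (h.1 j).2 - rdist w' (h.1 j).1 (h.1 j).2|) 1
          (fun j _ => by
            have e1 := rdist_sub_le w w' hw (h.1 j).1 (h.1 j).2
            have e2 := rdist_sub_le w' w hw.symm (h.1 j).1 (h.1 j).2
            exact abs_le.mpr ⟨by linarith, by linarith⟩)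
        simpa using this
      calc ε / 6 * ∑ e, |(w e : ℝ) - w' e| + ε / (6 * p) *
            ∑ j, |rdist w (h.1 j).1 (h.1 j).2 - rdist w' (h.1 j).1 (h.1 j).2|
          ≤ ε / 6 * 1 + ε / (6 * p) * p := by
            gcongr
            exact hw
        _ = ε / 3 := by field_simp; norm_num)
    (by
      intro w w' hw h
      have h1 := score_sub_le (L := L) hk w w' hw h.1
      have h2 := mul_le_mul_of_nonneg_left h1 (by positivity : 0 ≤ ε / (12 * k))
      rw [mul_add] at h2
      have h3 : ε / (12 * k) * (4 * k) = ε / 3 := by field_simp; norm_num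
      linarith)
  refine ⟨M, hM, fun w w' hw S hS => ?_, fun w => ?_⟩
  · have := hdp w w' hw S hS
    rw [show ε / 3 + 2 * (ε / 3) = ε by ring] at this
    simpa using this
  -- The threshold `(2p + 1) log n` leaves `1 / n` after the union over `n ^ (2p)` candidates. The
  -- radii give tails `2 / n ^ 3` for each of at most `n ^ 2` edges and `2 / n ^ 2` for each of at
  -- most `32 n` shortcuts, so the total failure is at most `67 / n`.
  · refine le_trans ?_ (hacc w _ (measurableSet_isAccurate w _ _) ((2 * p + 1 : ℕ) * l)
      (Sum.elim (fun _ => 36 * l / ε) (fun _ => 24 * p * l / ε)) ?_)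
    · have hcard : (Fintype.card (Candidate G p L (2 * k)) : ℝ) ≤ (n : ℝ) ^ (2 * p) := by
        rw [← Nat.card_eq_fintype_card]
        exact_mod_cast card_candidate_le (G := G) (p := p) L (2 * k)
      have h1 : (Fintype.card (Candidate G p L (2 * k)) : ℝ) *
          Real.exp (-((2 * p + 1 : ℕ) * l)) ≤ 1 / n := by
        rw [hexp]
        calc _ ≤ (n : ℝ) ^ (2 * p) * ((n : ℝ) ^ (2 * p + 1))⁻¹ := by gcongr
          _ = 1 / n := by rw [pow_succ]; field_simp
      have hE : (Fintype.card G.edgeSet : ℝ) ≤ (n : ℝ) ^ 2 := by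
        exact_mod_cast card_edgeSet_le G
      have h2 : (Fintype.card G.edgeSet : ℝ) * (2 * Real.exp (-(ε / 6 * (36 * l / ε) / 2)))
          ≤ 2 / n := by
        rw [show ε / 6 * (36 * l / ε) / 2 = (3 : ℕ) * l by field_simp; norm_num, hexp]
        calc _ ≤ (n : ℝ) ^ 2 * (2 * ((n : ℝ) ^ 3)⁻¹) := by gcongr
          _ = 2 / n := by field_simp
      have h3 : (p : ℝ) * (2 * Real.exp (-(ε / (6 * p) * (24 * p * l / ε) / 2)))
          ≤ 64 / n := by
        rw [show ε / (6 * p) * (24 * p * l / ε) / 2 = (2 : ℕ) * l by field_simp; norm_num, hexp]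
        calc _ ≤ (32 * n : ℝ) * (2 * ((n : ℝ) ^ 2)⁻¹) := by
              gcongr
              linarith
          _ = 64 / n := by field_simp; norm_num
      have h4 : (67 : ℝ) / n ≤ 3000 / n := by gcongr; norm_num
      have h5 : (67 : ℝ) / n = 1 / n + (2 / n + 64 / n) := by ring
      rw [Fintype.sum_sum_type]
      simp only [c, Sum.elim_inl, Sum.elim_inr, Finset.sum_const, Finset.card_univ,
        nsmul_eq_mul, Fintype.card_fin]
      linarith
    · intro h x hs hx
      refine isAccurate_estimate hk w h _ _ (s := 36 * l / ε) (t := 24 * p * l / ε)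
        (τ := 12 * k * ((2 * p + 1 : ℕ) * l) / ε) (by positivity) (by positivity)
        (fun e => hx (.inl e)) (fun j => hx (.inr j)) ?_ ?_
      · rw [le_div_iff₀ hε]
        rw [div_mul_eq_mul_div, div_le_iff₀ (by positivity)] at hs
        linarith
      · have e1 : 12 * k * ((2 * p + 1 : ℕ) * l) / ε + 2 * L * (36 * l / ε)
            + 2 * k * (24 * p * l / ε)
            = (12 * k * (2 * p + 1) * l + 72 * L * l + 48 * k * p * l) / ε := by
          push_cast
          ring
        rw [e1, ← mul_div_assoc]
        gcongr
        -- The numerator is `72 k p l + 12 k l + 72 L l`. With `1 ≤ p ≤ 32 X`, `L ≤ 2 X l` and `1 ≤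
        -- l` it is at most `(84 * 32 + 144) k X l ^ 2 = 2832 k X l ^ 2`.
        have hkl : 0 < k * l := by positivity
        have b1 : k * l * p ≤ k * l * (32 * X) := by gcongr
        have b2 : k * l * 1 ≤ k * l * p := by gcongr
        have b3 : k * l * X * 1 ≤ k * l * X * l := by gcongr
        have b4 : l * L ≤ l * (2 * X * l) := by gcongr
        have b5 : 1 * (X * l ^ 2) ≤ k * (X * l ^ 2) := by gcongr
        nlinarith

end PrivateAPSD

theorem mainTheorem4 :
    ∃ C : ℝ, 0 < C ∧
      ∀ (k : ℕ), 1 ≤ k → ∀ (ε : ℝ), 0 < ε →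
      ∀ (V : Type u) [Fintype V] (G : SimpleGraph V) [Fintype G.edgeSet],
        ∃ M : Kernel (PrivateAPSD.Weights G) (PrivateAPSD.Estimates V),
          IsMarkovKernel M ∧
          PrivateAPSD.IsDP M ε 0 ∧
          ∀ w : PrivateAPSD.Weights G,
            1 - C / (Fintype.card V : ℝ) ≤
              (M w).real {d | PrivateAPSD.IsAccurate w (2 * (k : ℝ) - 1)
                (C * ((k : ℝ) *
                  (Fintype.card V : ℝ) ^ (((k : ℝ) + 1) / (2 * (k : ℝ) + 1)) *
                  Real.log (Fintype.card V : ℝ) ^ 2 / ε)) d} := by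
  refine ⟨3000, by norm_num, fun k hk ε hε V _ G _ => ?_⟩
  rcases le_or_gt (Fintype.card V) 2 with hn | hn
  · exact PrivateAPSD.exists_kernel_of_card_le_two G hn (by norm_num) hε _ _
  · exact PrivateAPSD.exists_kernel_of_three_le_card G hn hk hε
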